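/- All matroids are finite. For a matroid $M$ with rank function $r_M$, let $\lambda_M(X)=r_M(X)+r_M(E(M)\setminus X)-r_M(E(M))$. A $k$-separation of $M$ is a partition $(X,Y)$ of $E(M)$ with $|X|,|Y|\ge k$ and $\lambda_M(X)<k$; $M$ is 3-connected if it has no $k$-separation with $k<3$. A tangle of $M$ of order $\theta$ is a collection $\mathcal T$ of subsets of $E(M)$ such that (i) $\lambda_M(X)<\theta$ for all $X\in\mathcal T$; (ii) if $X\subseteq E(M)$ and $\lambda_M(X)<\theta$ then $X\in\mathcal T$ or $E(M)\setminus X\in\mathcal T$; (iii) no three members of $\mathcal T$ have union $E(M)$; (iv) $E(M)\setminus\{e\}\notin\mathcal T$ for each $e\in E(M)$. The rank $r_{\mathcal T}(X)$ of $X\subseteq E(M)$ is $\min\{\lambda_M(Y): X\subseteq Y\in\mathcal T\}$ if some member of $\mathcal T$ contains $X$, and $\theta$ otherwise. Let $M$ be a 3-connected matroid and let $C,D\subseteq E(M)$ be disjoint sets such that $M/C\backslash D$ is 3-connected. The restoration graph $R(M,C,D)$ is the bipartite graph with vertex set $C\cup D$ in which $c\in C$ and $d\in D$ are adjacent if and only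 if $M/(C\setminus\{c\})\backslash(D\setminus\{d\})$ is 3-connected. A vertex $e\in C\cup D$ is privileged if $M/(C\setminus\{e\})\backslash(D\setminus\{e\})$ is 3-connected. A matching is a subgraph in which each vertex has degree 1; it is induced if it is an induced subgraph. Let $k$ be an integer, let $\mathcal T$ be a tangle of $M$, let $N$ be a minor of $M/C\backslash D$, let $t:=r_{\mathcal T}(E(N))$, and suppose that $r_{\mathcal T}(E(N)\cup C\cup D)=t+|C\cup D|$. If $R(M,C,D)$ contains an induced matching with at least $2k$ edges and no privileged vertices, then at least one of the following holds: 1. there is a set $C'\subseteq E(M)$ such that $r_{\mathcal T}(E(N)\cup C')=t+|C'|$, $|C'|\ge k$, and $M/C'$ is 3-connected with $N$ as a minor; 2. there is a set $D'\subseteq E(M)$ such that $r_{\mathcal T}(E(N)\cup D')=t+|D'|$, $|D'|\ge k$, and $M\backslash D'$ is 3-connected with $N$ as a minor. -/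

import Mathlib

open scoped Matroid

namespace MatroidTangle

variable {α : Type*}

/-- The rank of a set, as a natural number (used for finite matroids only). -/
noncomputable def rk (M : Matroid α) (X : Set α) : ℕ := (M.eRk X).toNat

/-- The connectivity function `λ_M(X) = r(X) + r(E ∖ X) - r(M)`. The subtraction does not
truncate, by submodularity of the rank. -/
noncomputable def conn (M : Matroid α) (X : Set α) : ℕ :=
  rk M X + rk M (M.E \ X) - rk M M.E

/-- `(X, Y)` is a `k`-separation of `M`. -/
structure IsSeparation (M : Matroid α) (k : ℕ) (X Y : Set α) : Prop where
  union_eq : X ∪ Y = M.E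
  disjoint : Disjoint X Y
  le_left : (k : ℕ∞) ≤ X.encard
  le_right : (k : ℕ∞) ≤ Y.encard
  conn_lt : conn M X < k

/-- `M` is `k`-connected: it has no `k'`-separation with `k' < k`. -/
def IsKConnected (M : Matroid α) (k : ℕ) : Prop :=
  ∀ k' < k, ∀ X Y : Set α, ¬ IsSeparation M k' X Y

/-- `T` is a tangle of `M` of order `θ`. -/
structure IsTangle (M : Matroid α) (T : Set (Set α)) (θ : ℕ) : Prop where
  subset_ground : ∀ X ∈ T, X ⊆ M.E
  conn_lt : ∀ X ∈ T, conn M X < θ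
  mem_or_compl_mem : ∀ X ⊆ M.E, conn M X < θ → X ∈ T ∨ M.E \ X ∈ T
  union_ne : ∀ X ∈ T, ∀ Y ∈ T, ∀ Z ∈ T, X ∪ Y ∪ Z ≠ M.E
  compl_singleton_notMem : ∀ e ∈ M.E, M.E \ {e} ∉ T

open Classical in
/-- The rank function of the tangle matroid of a tangle `T` of order `θ`:
the least `λ_M(Y)` over the members `Y` of `T` containing `X`, and `θ` if there is none. -/
noncomputable def tangleRank (M : Matroid α) (T : Set (Set α)) (θ : ℕ) (X : Set α) : ℕ :=
  if ∃ Y ∈ T, X ⊆ Y then sInf {n | ∃ Y ∈ T, X ⊆ Y ∧ conn M Y = n} else θ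

/-- The matroid obtained from `M ／ C ＼ D` by restoring `Z`. -/
def restore (M : Matroid α) (C D Z : Set α) : Matroid α := M ／ (C \ Z) ＼ (D \ Z)

/-- `e` is privileged: restoring `e` yields a 3-connected matroid. -/
def IsPrivileged (M : Matroid α) (C D : Set α) (e : α) : Prop :=
  IsKConnected (restore M C D {e}) 3

/-- `cd` is an edge of the restoration graph, with `c` in `C` and `d` in `D`. -/
def RestorationEdge (M : Matroid α) (C D : Set α) (c d : α) : Prop :=
  c ∈ C ∧ d ∈ D ∧ IsKConnected (M ／ (C \ {c}) ＼ (D \ {d})) 3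

/-- The restoration graph `R(M, C, D)`, with vertex set `C ∪ D`. -/
def restorationGraph (M : Matroid α) (C D : Set α) (hCD : Disjoint C D) :
    SimpleGraph ↥(C ∪ D) where
  Adj x y := RestorationEdge M C D x y ∨ RestorationEdge M C D y x
  symm := ⟨fun _ _ h => h.symm⟩
  loopless := ⟨fun _ h => by
    rcases h with h | h <;> exact Set.disjoint_left.1 hCD h.1 h.2.1⟩

end MatroidTangle

/-!
As no end of the matching is privileged, restoring a matched `d ∈ D` creates a parallel pair, along
a circuit `J ⊆ C ∪ {d, g}` of `M`, and restoring a matched `c ∈ C` creates a series pair, along a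
cocircuit `K ⊆ D ∪ {c, f}`. Since `C ∪ D` is free over `E(N)` in the tangle matroid, `J` and `K`
are unique and orthogonality gives `c ∈ J ↔ d ∈ K`, which holds exactly when `cd` is an edge.
Moreover contracting `C' ⊆ C` keeps `M` 3-connected as soon as it makes no element of `D` parallel
to another element; deletion of subsets of `D` is dual.

If the circuit `J` of a matched pair `cd` meets `C` outside `c`, then contracting all such `c`
creates no parallel pair at a matched `d`, and whenever it creates one at an unmatched element of
`D`, one contracted element is traded for the deletion of that element. Cocircuits `K` that meet
`D` outside `d` are dual. In every remaining pair `K` is a triad `{c, d, w}`. If `c` lies in a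
triangle, it is `{c, d, x}` and `d` can be exchanged for `x`, which lengthens the fan; then
one continues with a triad through `x`. Once the fan is maximal, its end can be contracted or
deleted. So each matching edge accounts for one contracted or one deleted element, and one of the
two sets contains at least half of the `2k` elements.
-/

open Set

namespace MatroidTangle

variable {α : Type*} {M N : Matroid α} {T : Set (Set α)} {θ : ℕ}
  {A B C C₁ D D₁ J K X Y : Set α} {a b c d e x : α}

/-! ### Rank and connectivity -/

section Rank

variable (M)

lemma coe_rk [M.RankFinite] (X : Set α) : (rk M X : ℕ∞) = M.eRk X := by
  rw [rk, ENat.natCast_toNat_eq_self]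
  exact ((M.eRk_le_eRank X).trans_lt (Matroid.eRank_lt_top_iff.2 inferInstance)).ne

lemma rk_mono [M.RankFinite] (h : X ⊆ Y) : rk M X ≤ rk M Y := by
  have := M.eRk_mono h
  simp only [← coe_rk] at this
  exact_mod_cast this

lemma rk_inter_add_rk_union_le [M.RankFinite] (X Y : Set α) :
    rk M (X ∩ Y) + rk M (X ∪ Y) ≤ rk M X + rk M Y := by
  have := M.eRk_inter_add_eRk_union_le X Y
  simp only [← coe_rk] at this
  exact_mod_cast this

lemma rk_union_le [M.RankFinite] (X Y : Set α) : rk M (X ∪ Y) ≤ rk M X + rk M Y := by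
  have := rk_inter_add_rk_union_le M X Y
  omega

lemma rk_le_ncard (hX : X.Finite) : rk M X ≤ X.ncard :=
  ENat.toNat_le_toNat (M.eRk_le_encard X) (encard_ne_top_iff.2 hX)

lemma rk_lt_ncard_iff_dep [M.Finite] (hX : X ⊆ M.E) : rk M X < X.ncard ↔ M.Dep X := by
  rw [← Matroid.eRk_lt_encard_iff_dep hX, ← coe_rk, ← (M.set_finite X).cast_ncard_eq]
  norm_cast

lemma rk_dual_add [M.Finite] (hX : X ⊆ M.E) :
    rk M✶ X + rk M M.E = rk M (M.E \ X) + X.ncard := by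
  have := M.eRk_dual_add_eRank X hX
  rw [← M.eRk_ground, ← (M.set_finite X).cast_ncard_eq] at this
  simp only [← coe_rk] at this
  exact_mod_cast this

lemma rk_delete (hX : Disjoint X D) : rk (M ＼ D) X = rk M X := by
  rw [rk, Matroid.delete_eq_restrict, Matroid.restrict_eRk_eq', rk, ← M.eRk_inter_ground X,
    ← inter_sdiff_assoc, (hX.mono_left inter_subset_left).sdiff_eq_left]

lemma rk_insert_of_mem_closure (hx : x ∈ M.closure X) : rk M (insert x X) = rk M X := by
  rw [rk, ← M.eRk_closure_eq, Matroid.closure_insert_eq_of_mem_closure hx, M.eRk_closure_eq, rk]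

end Rank

section Connectivity

variable (M)

lemma conn_add [M.RankFinite] (X : Set α) : conn M X + rk M M.E = rk M X + rk M (M.E \ X) := by
  have h := rk_inter_add_rk_union_le M X (M.E \ X)
  have h' := rk_mono M (show M.E ⊆ X ∪ (M.E \ X) by tauto_set)
  rw [conn]
  omega

lemma conn_add_ncard [M.Finite] (hX : X ⊆ M.E) : conn M X + X.ncard = rk M X + rk M✶ X := by
  have h1 := conn_add M X
  have h2 := rk_dual_add M hX
  omega

lemma conn_compl [M.RankFinite] (hX : X ⊆ M.E) : conn M (M.E \ X) = conn M X := by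
  have h1 := conn_add M X
  have h2 := conn_add M (M.E \ X)
  rw [sdiff_sdiff_cancel_left hX] at h2
  omega

lemma conn_dual [M.Finite] (hX : X ⊆ M.E) : conn M✶ X = conn M X := by
  have h1 := conn_add_ncard M hX
  have h2 := conn_add_ncard M✶ (X := X) hX
  rw [Matroid.dual_dual] at h2
  omega

lemma conn_le_ncard [M.RankFinite] (hX : X.Finite) : conn M X ≤ X.ncard := by
  have h1 := conn_add M X
  have h2 := rk_le_ncard M hX
  have h3 := rk_mono M (sdiff_subset : M.E \ X ⊆ M.E)
  omega

lemma conn_inter_add_conn_union_le [M.RankFinite] (X Y : Set α) :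
    conn M (X ∩ Y) + conn M (X ∪ Y) ≤ conn M X + conn M Y := by
  have h1 := conn_add M X
  have h2 := conn_add M Y
  have h3 := conn_add M (X ∩ Y)
  have h4 := conn_add M (X ∪ Y)
  have h5 := rk_inter_add_rk_union_le M X Y
  have h6 := rk_inter_add_rk_union_le M (M.E \ X) (M.E \ Y)
  rw [← sdiff_inter_sdiff, ← sdiff_inter] at *
  omega

lemma conn_delete_le [M.RankFinite] (D : Set α) (hX : X ⊆ M.E) :
    conn (M ＼ D) (X \ D) ≤ conn M X := by
  have h1 := conn_add M X
  have h2 := conn_add (M ＼ D) (X \ D)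
  rw [rk_delete _ disjoint_sdiff_left, Matroid.delete_ground, rk_delete _ disjoint_sdiff_left,
    rk_delete _ (disjoint_sdiff_left.mono_left sdiff_subset)] at h2
  have h3 := rk_inter_add_rk_union_le M X (M.E \ D)
  have h4 := rk_inter_add_rk_union_le M (M.E \ X) (X ∪ M.E \ D)
  rw [show X ∩ (M.E \ D) = X \ D by tauto_set] at h3
  rw [show M.E \ X ∩ (X ∪ M.E \ D) = (M.E \ D) \ (X \ D) by tauto_set,
    show M.E \ X ∪ (X ∪ M.E \ D) = M.E by tauto_set] at h4
  omega

lemma conn_contract_le [M.Finite] (C : Set α) (hX : X ⊆ M.E) :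
    conn (M ／ C) (X \ C) ≤ conn M X := by
  have h := conn_delete_le M✶ C (X := X) hX
  rwa [← Matroid.dual_contract, conn_dual M hX,
    conn_dual (M ／ C) (by simpa using sdiff_subset_sdiff_left hX)] at h

lemma conn_contract_delete_le [M.Finite] (C D : Set α) (hX : X ⊆ M.E) :
    conn (M ／ C ＼ D) (X \ (C ∪ D)) ≤ conn M X := by
  rw [← sdiff_sdiff]
  exact (conn_delete_le (M ／ C) D (sdiff_subset_sdiff_left hX)).trans (conn_contract_le M C hX)

lemma conn_union_le_conn_delete_add [M.Finite] (hX : Disjoint X D) (hD : D ⊆ M.E) :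
    conn M (X ∪ D) ≤ conn (M ＼ D) X + D.ncard := by
  have h1 := conn_add M (X ∪ D)
  have h2 := conn_add (M ＼ D) X
  rw [rk_delete _ hX, Matroid.delete_ground, rk_delete _ disjoint_sdiff_left,
    rk_delete _ (disjoint_sdiff_left.mono_left sdiff_subset)] at h2
  have h3 := rk_union_le M X D
  have h4 := rk_le_ncard M (M.set_finite D)
  have h5 := rk_mono M (show M.E \ D ⊆ M.E from sdiff_subset)
  rw [show M.E \ (X ∪ D) = (M.E \ D) \ X by tauto_set] at h1
  omega

lemma conn_union_le_conn_contract_add [M.Finite] (hX : X ⊆ M.E) (hXC : Disjoint X C)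
    (hC : C ⊆ M.E) : conn M (X ∪ C) ≤ conn (M ／ C) X + C.ncard := by
  have h := conn_union_le_conn_delete_add M✶ hXC (D := C) hC
  rwa [← Matroid.dual_contract, conn_dual M (union_subset hX hC),
    conn_dual (M ／ C) (by simpa using subset_sdiff.2 ⟨hX, hXC⟩)] at h

lemma conn_union_le_conn_contract_delete_add [M.Finite] (hX : X ⊆ M.E \ (C ∪ D)) (hC : C ⊆ M.E)
    (hD : D ⊆ M.E) (hCD : Disjoint C D) :
    conn M (X ∪ (C ∪ D)) ≤ conn (M ／ C ＼ D) X + (C ∪ D).ncard := by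
  obtain ⟨hXE, hXCD⟩ := subset_sdiff.1 hX
  rw [disjoint_union_right] at hXCD
  have h1 := conn_union_le_conn_delete_add (M ／ C) hXCD.2 (subset_sdiff.2 ⟨hD, hCD.symm⟩)
  have h2 := conn_union_le_conn_contract_add M (union_subset hXE hD)
    (disjoint_union_left.2 ⟨hXCD.1, hCD.symm⟩) hC
  rw [union_assoc, union_comm D C] at h2
  rw [ncard_union_eq hCD (M.set_finite C) (M.set_finite D)]
  omega

variable {M}

lemma conn_delete_singleton_eq [M.RankFinite] (hx : x ∈ M.closure X) (hxX : x ∉ X) :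
    conn (M ＼ {x}) X = conn M (insert x X) := by
  have h1 := conn_add M (insert x X)
  have h2 := conn_add (M ＼ {x}) X
  have hE := rk_insert_of_mem_closure M (X := M.E \ {x}) <|
    M.closure_subset_closure (subset_sdiff_singleton inter_subset_right (hxX ·.1))
      (M.closure_inter_ground X ▸ hx)
  rw [insert_sdiff_self_of_mem (M.mem_ground_of_mem_closure hx)] at hE
  rw [rk_insert_of_mem_closure M hx] at h1
  rw [Matroid.delete_ground, rk_delete _ disjoint_sdiff_left,
    rk_delete _ (disjoint_singleton_right.2 hxX),
    rk_delete _ (disjoint_sdiff_left.mono_left sdiff_subset), sdiff_sdiff, singleton_union] at h2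
  omega

lemma conn_lt_ncard_of_dep [M.Finite] (h : M.Dep X) : conn M X < X.ncard := by
  have h1 := conn_add_ncard M h.subset_ground
  have h2 := rk_le_ncard M✶ (M.set_finite X h.subset_ground)
  have h3 := (rk_lt_ncard_iff_dep M h.subset_ground).2 h
  omega

end Connectivity

section KConnected

variable {k : ℕ}

lemma isKConnected_iff [M.Finite] : IsKConnected M k ↔
    ∀ j < k, ∀ X ⊆ M.E, j ≤ X.ncard → j ≤ (M.E \ X).ncard → j ≤ conn M X := by
  simp only [← Nat.cast_le (α := ℕ∞), (M.ground_finite.sdiff).cast_ncard_eq]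
  refine ⟨fun h j hj X hX h1 h2 ↦ ?_, fun h j hj X Y hs ↦ ?_⟩
  · by_contra! hlt
    rw [(M.set_finite X).cast_ncard_eq] at h1
    exact h j hj X (M.E \ X)
      ⟨union_sdiff_cancel hX, disjoint_sdiff_right, h1, h2, by exact_mod_cast hlt⟩
  · have hX : X ⊆ M.E := hs.union_eq ▸ subset_union_left
    have hY : M.E \ X = Y := by
      rw [← hs.union_eq, union_sdiff_left, hs.disjoint.sdiff_eq_right]
    refine hs.conn_lt.not_ge (Nat.cast_le.1 (h j hj X hX ?_ (hY ▸ hs.le_right)))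
    rw [(M.set_finite X).cast_ncard_eq]
    exact hs.le_left

lemma isKConnected_dual_iff [M.Finite] : IsKConnected M✶ k ↔ IsKConnected M k := by
  rw [isKConnected_iff, isKConnected_iff]
  refine forall₄_congr fun j _ X hX ↦ ?_
  rw [conn_dual M hX, Matroid.dual_ground]

lemma IsKConnected.dual [M.Finite] (hM : IsKConnected M k) : IsKConnected M✶ k :=
  isKConnected_dual_iff.2 hM

lemma IsKConnected.le_ncard_of_dep [M.Finite] (hM : IsKConnected M k)
    (hE : 2 * k ≤ M.E.ncard + 2) (h : M.Dep X) : k ≤ X.ncard := by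
  by_contra! hlt
  have hX := h.subset_ground
  have h1 := conn_lt_ncard_of_dep h
  have h2 := ncard_sdiff_add_ncard_of_subset hX M.ground_finite
  have h3 := isKConnected_iff.1 hM _ hlt X hX le_rfl (by omega)
  omega

lemma IsKConnected.delete_of_parallel [M.Finite] (hbx : b ≠ x) (h : M.IsCircuit {b, x})
    (hM : IsKConnected (M ＼ {b}) k) : IsKConnected (M ＼ {x}) k := by
  rw [isKConnected_iff] at hM ⊢
  intro j hj X hX h1 h2
  wlog hbX : b ∈ X generalizing X
  · rw [← conn_compl _ hX]
    exact this _ sdiff_subset h2 (by rwa [sdiff_sdiff_cancel_left hX])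
      ⟨⟨h.subset_ground (mem_insert b _), hbx⟩, hbX⟩
  have hxX : x ∉ X := fun hx ↦ (hX hx).2 rfl
  have hbX' : b ∉ insert x (X \ {b}) := by simp [hbx]
  have hxb : insert b (insert x (X \ {b})) = insert x X := by
    rw [insert_comm, insert_sdiff_self_of_mem hbX]
  have hcompl : (M.E \ {b}) \ insert x (X \ {b}) = (M.E \ {x}) \ X := by
    rw [sdiff_sdiff, sdiff_sdiff, singleton_union, singleton_union, hxb]
  have hx : x ∈ M.closure X := (Matroid.mem_closure_iff_exists_isCircuit hxX).2
    ⟨_, pair_subset (Or.inr hbX) (Or.inl rfl), h, Or.inr rfl⟩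
  have hb : b ∈ M.closure (insert x (X \ {b})) :=
    (Matroid.mem_closure_iff_exists_isCircuit hbX').2
      ⟨_, pair_subset (Or.inl rfl) (Or.inr (Or.inl rfl)), h, Or.inl rfl⟩
  rw [conn_delete_singleton_eq hx hxX, ← hxb, ← conn_delete_singleton_eq hb hbX']
  refine hM j hj _ (subset_sdiff_singleton ?_ hbX') ?_ (by rwa [Matroid.delete_ground, hcompl])
  · exact insert_subset (M.mem_ground_of_mem_closure hx)
      (sdiff_subset.trans (hX.trans sdiff_subset))
  · rwa [ncard_exchange hxX hbX]

end KConnected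

/-! ### Tangles -/

section Tangle

lemma tangleRank_le_conn (hY : Y ∈ T) (h : X ⊆ Y) : tangleRank M T θ X ≤ conn M Y := by
  rw [tangleRank, if_pos ⟨Y, hY, h⟩]
  exact Nat.sInf_le ⟨Y, hY, h, rfl⟩

lemma exists_conn_eq_tangleRank (h : tangleRank M T θ X < θ) :
    ∃ Y ∈ T, X ⊆ Y ∧ conn M Y = tangleRank M T θ X := by
  rw [tangleRank] at h ⊢
  split_ifs at h ⊢ with hX
  · obtain ⟨Y, hY, hXY⟩ := hX
    exact Nat.sInf_mem (s := {n | ∃ Y ∈ T, X ⊆ Y ∧ conn M Y = n}) ⟨_, Y, hY, hXY, rfl⟩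
  · exact absurd h (lt_irrefl θ)

namespace IsTangle

lemma mem_of_subset (hT : IsTangle M T θ) (hY : Y ∈ T) (h : X ⊆ Y) (hc : conn M X < θ) :
    X ∈ T := by
  have hYE := hT.subset_ground Y hY
  refine (hT.mem_or_compl_mem X (h.trans hYE) hc).resolve_right fun h' ↦ ?_
  exact hT.union_ne _ h' Y hY Y hY (by tauto_set)

lemma union_mem (hT : IsTangle M T θ) (hX : X ∈ T) (hY : Y ∈ T) (hc : conn M (X ∪ Y) < θ) :
    X ∪ Y ∈ T := by
  have hXY := union_subset (hT.subset_ground X hX) (hT.subset_ground Y hY)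
  refine (hT.mem_or_compl_mem _ hXY hc).resolve_right fun h' ↦ ?_
  exact hT.union_ne _ h' X hX Y hY (by rw [union_assoc, sdiff_union_of_subset hXY])

lemma singleton_mem (hT : IsTangle M T θ) (he : e ∈ M.E) (hc : conn M {e} < θ) : {e} ∈ T :=
  (hT.mem_or_compl_mem _ (singleton_subset_iff.2 he) hc).resolve_right
    (hT.compl_singleton_notMem e he)

lemma mem_of_ncard_lt [M.Finite] (hT : IsTangle M T θ) (hX : X ⊆ M.E) (h : X.ncard < θ) :
    X ∈ T := by
  induction X, M.set_finite X using Set.Finite.induction_on with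
  | empty =>
    have h0 := conn_le_ncard M finite_empty
    refine (hT.mem_or_compl_mem ∅ (empty_subset _) (by omega)).resolve_right fun h' ↦ ?_
    exact hT.union_ne _ h' _ h' _ h' (by simp)
  | @insert e X heX hXfin ih =>
    have hc := conn_le_ncard M (hXfin.insert e)
    have he := conn_le_ncard M (finite_singleton e)
    rw [ncard_insert_of_notMem heX hXfin] at h hc
    rw [ncard_singleton] at he
    rw [insert_subset_iff] at hX
    rw [← singleton_union] at hc ⊢
    exact hT.union_mem (hT.singleton_mem hX.1 (by omega)) (ih hX.2 (by omega)) (by omega)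

lemma mem_of_ncard_le [M.Finite] (hT : IsTangle M T θ) (hX : X ⊆ M.E)
    (h : X.ncard + 2 ≤ 2 * θ) (hc : conn M X < θ) : X ∈ T := by
  obtain hlt | hle := lt_or_ge X.ncard θ
  · exact hT.mem_of_ncard_lt hX hlt
  obtain ⟨A, hAX, hA⟩ := exists_subset_card_eq (s := X) (n := θ - 1) (by omega)
  have hB := ncard_sdiff_add_ncard_of_subset hAX (M.set_finite X)
  rw [← union_sdiff_cancel hAX] at hc ⊢
  exact hT.union_mem (hT.mem_of_ncard_lt (hAX.trans hX) (by omega))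
    (hT.mem_of_ncard_lt (sdiff_subset.trans hX) (by omega)) hc

lemma le_ncard_compl [M.Finite] (hT : IsTangle M T θ) (hY : Y ∈ T) :
    θ ≤ (M.E \ Y).ncard := by
  by_contra! h
  exact hT.union_ne _ (hT.mem_of_ncard_lt sdiff_subset h) Y hY Y hY
    (by rw [union_assoc, union_self, sdiff_union_of_subset (hT.subset_ground Y hY)])

lemma tangleRank_le (hT : IsTangle M T θ) (X : Set α) : tangleRank M T θ X ≤ θ := by
  by_cases h : ∃ Y ∈ T, X ⊆ Y
  · obtain ⟨Y, hY, hXY⟩ := h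
    exact (tangleRank_le_conn hY hXY).trans (hT.conn_lt Y hY).le
  · rw [tangleRank, if_neg h]

lemma tangleRank_mono (hT : IsTangle M T θ) (h : X ⊆ Y) :
    tangleRank M T θ X ≤ tangleRank M T θ Y := by
  by_cases hY : tangleRank M T θ Y < θ
  · obtain ⟨Z, hZ, hYZ, hc⟩ := exists_conn_eq_tangleRank hY
    exact hc ▸ tangleRank_le_conn hZ (h.trans hYZ)
  · exact (hT.tangleRank_le X).trans (not_lt.1 hY)

lemma tangleRank_le_conn_of_imp (hT : IsTangle M T θ) (h : X ⊆ Y) (hY : conn M Y < θ → Y ∈ T) :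
    tangleRank M T θ X ≤ conn M Y := by
  by_cases hc : conn M Y < θ
  · exact tangleRank_le_conn (hY hc) h
  · exact (hT.tangleRank_le X).trans (not_lt.1 hc)

lemma tangleRank_le_conn_of_ncard_le [M.Finite] (hT : IsTangle M T θ) (hX : X ⊆ M.E)
    (h : X.ncard + 2 ≤ 2 * θ) : tangleRank M T θ X ≤ conn M X :=
  hT.tangleRank_le_conn_of_imp Subset.rfl (hT.mem_of_ncard_le hX h)

lemma tangleRank_inter_add_tangleRank_union_le [M.RankFinite] (hT : IsTangle M T θ)
    (X Y : Set α) : tangleRank M T θ (X ∩ Y) + tangleRank M T θ (X ∪ Y) ≤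
      tangleRank M T θ X + tangleRank M T θ Y := by
  have hU := hT.tangleRank_le (X ∪ Y)
  obtain hX | hX := le_or_gt θ (tangleRank M T θ X)
  · have hI := hT.tangleRank_mono (inter_subset_right (s := X) (t := Y))
    omega
  obtain hY | hY := le_or_gt θ (tangleRank M T θ Y)
  · have hI := hT.tangleRank_mono (inter_subset_left (s := X) (t := Y))
    omega
  obtain ⟨A, hA, hXA, hcA⟩ := exists_conn_eq_tangleRank hX
  obtain ⟨B, hB, hYB, hcB⟩ := exists_conn_eq_tangleRank hY
  have h := conn_inter_add_conn_union_le M A B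
  have hI := hT.tangleRank_le_conn_of_imp (inter_subset_inter hXA hYB)
    (hT.mem_of_subset hA inter_subset_left)
  have hU := hT.tangleRank_le_conn_of_imp (union_subset_union hXA hYB) (hT.union_mem hA hB)
  omega

lemma tangleRank_singleton_le [M.RankFinite] (hT : IsTangle M T θ) (he : e ∈ M.E) :
    tangleRank M T θ {e} ≤ 1 := by
  have h := conn_le_ncard M (finite_singleton e)
  rw [ncard_singleton] at h
  exact (hT.tangleRank_le_conn_of_imp Subset.rfl (hT.singleton_mem he)).trans h

lemma tangleRank_union_le_add_ncard [M.Finite] (hT : IsTangle M T θ) (X : Set α)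
    (hY : Y ⊆ M.E) : tangleRank M T θ (X ∪ Y) ≤ tangleRank M T θ X + Y.ncard := by
  induction Y, M.set_finite Y using Set.Finite.induction_on with
  | empty => simp
  | @insert e Y heY hYfin ih =>
    rw [insert_subset_iff] at hY
    have h1 := ih hY.2
    have h2 := hT.tangleRank_inter_add_tangleRank_union_le (X ∪ Y) {e}
    have h3 := hT.tangleRank_singleton_le hY.1
    rw [ncard_insert_of_notMem heY hYfin]
    rw [union_singleton, ← union_insert] at h2
    omega

lemma tangleRank_lt_ncard_of_dep [M.Finite] (hT : IsTangle M T θ) (hθ : 2 ≤ θ) (hX : M.Dep X) :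
    tangleRank M T θ X < X.ncard := by
  by_cases h : θ < X.ncard
  · exact (hT.tangleRank_le X).trans_lt h
  · exact (hT.tangleRank_le_conn_of_ncard_le hX.subset_ground (by omega)).trans_lt
      (conn_lt_ncard_of_dep hX)

lemma le_tangleRank [M.Finite] {j k : ℕ} (hT : IsTangle M T θ) (hM : IsKConnected M k)
    (hj : j < k) (hjθ : j ≤ θ) (hX : j ≤ X.ncard) : j ≤ tangleRank M T θ X := by
  by_contra! h
  obtain ⟨Y, hY, hXY, hc⟩ := exists_conn_eq_tangleRank (h.trans_le hjθ)
  have hYE := hT.subset_ground Y hY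
  have h1 := ncard_le_ncard hXY (M.set_finite Y)
  have h2 := isKConnected_iff.1 hM j hj Y hYE (by omega) (hjθ.trans (hT.le_ncard_compl hY))
  omega

lemma dual [M.Finite] (hT : IsTangle M T θ) : IsTangle M✶ T θ where
  subset_ground := hT.subset_ground
  conn_lt X hX := by
    rw [conn_dual M (hT.subset_ground X hX)]
    exact hT.conn_lt X hX
  mem_or_compl_mem X hX h := hT.mem_or_compl_mem X hX (by rwa [conn_dual M hX] at h)
  union_ne := hT.union_ne
  compl_singleton_notMem := hT.compl_singleton_notMem

lemma tangleRank_dual [M.Finite] (hT : IsTangle M T θ) (X : Set α) :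
    tangleRank M✶ T θ X = tangleRank M T θ X := by
  have h : {n | ∃ Y ∈ T, X ⊆ Y ∧ conn M✶ Y = n} = {n | ∃ Y ∈ T, X ⊆ Y ∧ conn M Y = n} := by
    ext n
    refine exists_congr fun Y ↦ and_congr_right fun hY ↦ ?_
    rw [conn_dual M (hT.subset_ground Y hY)]
  simp only [tangleRank, h]

end IsTangle

end Tangle

/-! ### Minors -/

section Minor

lemma subsingleton_ncard_le_one (hX : X.Subsingleton) : X.ncard ≤ 1 := by
  have := hX.finite.to_subtype
  exact ncard_le_one_iff_subsingleton.2 hX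

lemma contract_delete_ground (M : Matroid α) (C D : Set α) : (M ／ C ＼ D).E = M.E \ (C ∪ D) := by
  rw [Matroid.delete_ground, Matroid.contract_ground, sdiff_sdiff]

lemma isMinor_dual (h : N ≤m M) : N✶ ≤m M✶ := by
  obtain ⟨C, D, -, -, hCD, rfl⟩ := h.exists_eq_contract_delete_disjoint
  exact ⟨D, C, by rw [Matroid.contract_delete_comm _ hCD, Matroid.dual_delete_contract]⟩

lemma isMinor_delete_or_contract_of_notMem (h : N ≤m M) (hxM : x ∈ M.E) (hxN : x ∉ N.E) :
    N ≤m M ＼ {x} ∨ N ≤m M ／ {x} := by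
  obtain ⟨A, B, -, -, hAB, rfl⟩ := h.exists_eq_contract_delete_disjoint
  by_cases hxA : x ∈ A
  · exact Or.inr ⟨A, B, by
      rw [Matroid.contract_contract, singleton_union, insert_eq_of_mem hxA]⟩
  · have hxB : x ∈ B := by
      by_contra hxB
      exact hxN ⟨⟨hxM, hxA⟩, hxB⟩
    exact Or.inl ⟨A, B, by
      rw [Matroid.contract_delete_comm _ hAB, Matroid.contract_delete_comm _ hAB,
        Matroid.delete_delete, singleton_union, insert_eq_of_mem hxB]⟩

lemma contract_delete_eq_contract_pair_of_parallel (hbx : b ≠ x) (h : M.IsCircuit {b, x}) :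
    M ／ {b} ＼ {x} = M ／ {b, x} := by
  have hx : x ∈ M.closure {b} := (Matroid.mem_closure_iff_exists_isCircuit
    (notMem_singleton_iff.2 hbx.symm)).2 ⟨_, (pair_comm b x).subset, h, Or.inr rfl⟩
  rw [← Matroid.contract_eq_delete_of_subset_loops, Matroid.contract_contract, singleton_union]
  rw [Matroid.contract_loops_eq, singleton_subset_iff]
  exact ⟨hx, hbx.symm⟩

lemma isMinor_delete_of_parallel (hbx : b ≠ x) (h : M.IsCircuit {b, x}) (hN : N ≤m M ＼ {b})
    (hxN : x ∉ N.E) : N ≤m M ＼ {x} := by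
  have hxE : x ∈ (M ＼ {b}).E := ⟨h.subset_ground (Or.inr rfl), hbx.symm⟩
  have hdisj : Disjoint {b} {x} := disjoint_singleton.2 hbx
  rcases isMinor_delete_or_contract_of_notMem hN hxE hxN with h1 | h1
  · rw [Matroid.delete_comm] at h1
    exact h1.trans ⟨∅, {b}, by simp⟩
  · rw [← Matroid.contract_delete_comm _ hdisj.symm,
      contract_delete_eq_contract_pair_of_parallel hbx.symm (pair_comm b x ▸ h), pair_comm,
      ← contract_delete_eq_contract_pair_of_parallel hbx h,
      Matroid.contract_delete_comm _ hdisj] at h1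
    exact h1.trans ⟨{b}, ∅, by simp⟩

end Minor

/-- `M ／ C ＼ D` is a 3-connected minor, with `N` as a minor, of the 3-connected matroid `M`, and
`C ∪ D` has at least four elements and is independent in the matroid obtained from the tangle
matroid of `T` by contracting the ground set of `N`. -/
structure IsFreeMinor (M N : Matroid α) (T : Set (Set α)) (θ : ℕ) (C D : Set α) : Prop where
  isKConnected : IsKConnected M 3
  isTangle : IsTangle M T θ
  left_subset : C ⊆ M.E
  right_subset : D ⊆ M.E
  disjoint : Disjoint C D
  isKConnected_minor : IsKConnected (M ／ C ＼ D) 3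
  isMinor : N ≤m M ／ C ＼ D
  rank_eq : tangleRank M T θ (N.E ∪ C ∪ D) = tangleRank M T θ N.E + (C ∪ D).ncard
  four_le : 4 ≤ (C ∪ D).ncard

/-- `J` is a circuit of `M` through `d` with at most one element outside `C ∪ {d}`. When `C ∪ {d}`
is independent, such a `J` witnesses that `d` is parallel to another element in `M ／ C`; applied
to `M✶` it describes series pairs. -/
structure IsParallelCircuit (M : Matroid α) (C : Set α) (d : α) (J : Set α) : Prop where
  isCircuit : M.IsCircuit J
  mem : d ∈ J
  sdiff_subsingleton : (J \ insert d C).Subsingleton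

lemma IsParallelCircuit.mono (hJ : IsParallelCircuit M C₁ d J) (hC : C₁ ⊆ C) :
    IsParallelCircuit M C d J :=
  ⟨hJ.isCircuit, hJ.mem,
    hJ.sdiff_subsingleton.anti (sdiff_subset_sdiff_right (insert_subset_insert hC))⟩

lemma IsParallelCircuit.sdiff_singleton_subset (hJ : IsParallelCircuit M C d J) (hx : x ∈ J)
    (hxC : x ∉ insert d C) : J \ {x} ⊆ insert d C := by
  rintro z ⟨hzJ, hzx⟩
  by_contra hz
  exact hzx (hJ.sdiff_subsingleton ⟨hzJ, hz⟩ ⟨hx, hxC⟩)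

namespace IsFreeMinor

lemma union_subset_ground (h : IsFreeMinor M N T θ C D) : C ∪ D ⊆ M.E :=
  union_subset h.left_subset h.right_subset

lemma ncard_le (h : IsFreeMinor M N T θ C D) : (C ∪ D).ncard ≤ θ := by
  have h1 := h.rank_eq
  have h2 := h.isTangle.tangleRank_le (N.E ∪ C ∪ D)
  omega

lemma four_le_order (h : IsFreeMinor M N T θ C D) : 4 ≤ θ := h.four_le.trans h.ncard_le

variable [M.Finite]

lemma dual (h : IsFreeMinor M N T θ C D) : IsFreeMinor M✶ N✶ T θ D C where
  isKConnected := h.isKConnected.dual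
  isTangle := h.isTangle.dual
  left_subset := h.right_subset
  right_subset := h.left_subset
  disjoint := h.disjoint.symm
  isKConnected_minor := by
    rw [← Matroid.dual_delete_contract, ← Matroid.contract_delete_comm _ h.disjoint]
    exact h.isKConnected_minor.dual
  isMinor := by
    rw [← Matroid.dual_delete_contract, ← Matroid.contract_delete_comm _ h.disjoint]
    exact isMinor_dual h.isMinor
  rank_eq := by
    rw [h.isTangle.tangleRank_dual, h.isTangle.tangleRank_dual, union_comm D C,
      Matroid.dual_ground, union_right_comm]
    exact h.rank_eq
  four_le := by
    rw [union_comm]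
    exact h.four_le

lemma tangleRank_union (h : IsFreeMinor M N T θ C D) (hA : A ⊆ C ∪ D) :
    tangleRank M T θ (N.E ∪ A) = tangleRank M T θ N.E + A.ncard := by
  have hE := h.union_subset_ground
  have h1 := h.isTangle.tangleRank_union_le_add_ncard N.E (hA.trans hE)
  have h2 := h.isTangle.tangleRank_union_le_add_ncard (N.E ∪ A) (Y := (C ∪ D) \ A)
    (sdiff_subset.trans hE)
  have h3 := h.rank_eq
  have h4 := ncard_sdiff_add_ncard_of_subset hA (M.set_finite _ hE)
  rw [union_assoc, union_sdiff_cancel hA, ← union_assoc] at h2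
  omega

lemma ncard_le_tangleRank (h : IsFreeMinor M N T θ C D) (hA : A ⊆ C ∪ D) :
    A.ncard ≤ tangleRank M T θ A := by
  have h1 := h.tangleRank_union hA
  have h2 := h.isTangle.tangleRank_inter_add_tangleRank_union_le N.E A
  omega

lemma tangleRank_lt_ncard_of_dep (h : IsFreeMinor M N T θ C D) (hA : M.Dep A) :
    tangleRank M T θ A < A.ncard :=
  h.isTangle.tangleRank_lt_ncard_of_dep (by have := h.four_le_order; omega) hA

lemma indep (h : IsFreeMinor M N T θ C D) (hA : A ⊆ C ∪ D) : M.Indep A := by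
  by_contra hi
  exact (h.ncard_le_tangleRank hA).not_gt
    (h.tangleRank_lt_ncard_of_dep ⟨hi, hA.trans h.union_subset_ground⟩)

lemma tangleRank_insert_inter_le (h : IsFreeMinor M N T θ C D) (hA : A ⊆ C ∪ D) (hB : B ⊆ C ∪ D)
    (hxA : tangleRank M T θ (insert x A) ≤ A.ncard)
    (hxB : tangleRank M T θ (insert x B) ≤ B.ncard) :
    tangleRank M T θ (insert x (A ∩ B)) ≤ (A ∩ B).ncard := by
  have hfin := M.set_finite _ h.union_subset_ground
  have h1 := h.isTangle.tangleRank_inter_add_tangleRank_union_le (insert x A) (insert x B)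
  rw [← insert_inter_distrib, ← insert_union_distrib] at h1
  have h2 := h.isTangle.tangleRank_mono (subset_insert x (A ∪ B))
  have h3 := h.ncard_le_tangleRank (union_subset hA hB)
  have h4 := ncard_union_add_ncard_inter A B (hfin.subset hA) (hfin.subset hB)
  omega

lemma four_le_ncard_compl (h : IsFreeMinor M N T θ C D) : 4 ≤ (M.E \ (C ∪ D)).ncard := by
  have hCD := h.union_subset_ground
  have h4 := h.four_le
  have hθ := h.ncard_le
  obtain ⟨e, he⟩ : (C ∪ D).Nonempty := nonempty_of_ncard_ne_zero (by omega)
  have hadd := ncard_sdiff_singleton_add_one he (M.set_finite _ hCD)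
  have hone := ncard_singleton e
  by_contra! hlt
  refine h.isTangle.union_ne (M.E \ (C ∪ D)) ?_ ((C ∪ D) \ {e}) ?_ {e} ?_ ?_
  · exact h.isTangle.mem_of_ncard_lt sdiff_subset (hlt.trans_le h.four_le_order)
  · exact h.isTangle.mem_of_ncard_lt (sdiff_subset.trans hCD) (by omega)
  · exact h.isTangle.mem_of_ncard_lt (singleton_subset_iff.2 (hCD he)) (by omega)
  · rw [union_assoc, sdiff_union_of_subset (singleton_subset_iff.2 he), sdiff_union_of_subset hCD]

lemma three_le_ncard_circuit (h : IsFreeMinor M N T θ C D) (hJ : M.IsCircuit J) :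
    3 ≤ J.ncard := by
  refine h.isKConnected.le_ncard_of_dep ?_ hJ.dep
  have h1 := h.four_le_ncard_compl
  have h2 := ncard_le_ncard (sdiff_subset : M.E \ (C ∪ D) ⊆ M.E) M.ground_finite
  omega

lemma three_le_ncard_circuit_sdiff (h : IsFreeMinor M N T θ C D) (hJ : M.IsCircuit J)
    (hJD : Disjoint J D) : 3 ≤ (J \ C).ncard := by
  have hJC : ¬ J ⊆ C := fun hs ↦ hJ.not_indep (h.indep (hs.trans subset_union_left))
  refine h.isKConnected_minor.le_ncard_of_dep ?_ ?_
  · have := h.four_le_ncard_compl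
    rw [contract_delete_ground]
    omega
  · exact Matroid.delete_dep_iff.2
      ⟨hJ.contract_dep_of_not_subset hJC, hJD.mono_left sdiff_subset⟩

lemma exists_sdiff_eq_singleton (h : IsFreeMinor M N T θ C D) (hC₁ : C₁ ⊆ C) (hd : d ∈ D)
    (hJ : IsParallelCircuit M C₁ d J) : ∃ g ∉ C ∪ D, J \ insert d C₁ = {g} := by
  obtain ⟨g, hgJ, hg⟩ := not_subset.1 fun hs ↦ hJ.isCircuit.not_indep (h.indep hs)
  have hgd : g ∉ insert d C₁ := fun hg' ↦
    hg (insert_subset (a := d) (Or.inr hd) (hC₁.trans subset_union_left) hg')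
  exact ⟨g, hg, hJ.sdiff_subsingleton.eq_singleton_of_mem ⟨hgJ, hgd⟩⟩

lemma inter_right_eq_singleton (h : IsFreeMinor M N T θ C D) (hC₁ : C₁ ⊆ C) (hd : d ∈ D)
    (hJ : IsParallelCircuit M C₁ d J) : J ∩ D = {d} := by
  obtain ⟨g, hg, hJg⟩ := h.exists_sdiff_eq_singleton hC₁ hd hJ
  refine Subset.antisymm (fun z ⟨hzJ, hzD⟩ ↦ ?_) (singleton_subset_iff.2 ⟨hJ.mem, hd⟩)
  by_contra hzd
  have hzC : z ∉ C₁ := fun hzC ↦ h.disjoint.le_bot ⟨hC₁ hzC, hzD⟩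
  have hzg : z = g := hJg.subset ⟨hzJ, fun hz ↦ hz.elim hzd hzC⟩
  exact hg (hzg ▸ Or.inr hzD)

lemma parallelCircuit_unique (h : IsFreeMinor M N T θ C D) (hd : d ∈ D)
    (hJ : IsParallelCircuit M C d J) (hK : IsParallelCircuit M C d K) : J = K := by
  by_contra hne
  obtain ⟨L, hLs, hL⟩ := hJ.isCircuit.elimination hK.isCircuit hne d
  obtain ⟨g, -, hJg⟩ := h.exists_sdiff_eq_singleton Subset.rfl hd hJ
  obtain ⟨f, -, hKf⟩ := h.exists_sdiff_eq_singleton Subset.rfl hd hK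
  have hLC : L \ C ⊆ {g, f} := by
    rintro z ⟨hzL, hzC⟩
    have hzd : z ∉ insert d C := fun hz ↦ hz.elim (hLs hzL).2 hzC
    exact (hLs hzL).1.imp (fun hzJ ↦ hJg.subset ⟨hzJ, hzd⟩) (fun hzK ↦ hKf.subset ⟨hzK, hzd⟩)
  have hLD : Disjoint L D := by
    refine disjoint_left.2 fun z hzL hzD ↦ (hLs hzL).2 ?_
    exact (hLs hzL).1.elim
      (fun hzJ ↦ (h.inter_right_eq_singleton Subset.rfl hd hJ).subset ⟨hzJ, hzD⟩)
      (fun hzK ↦ (h.inter_right_eq_singleton Subset.rfl hd hK).subset ⟨hzK, hzD⟩)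
  have h1 := h.three_le_ncard_circuit_sdiff hL hLD
  have h2 := ncard_le_ncard hLC
  have h3 := ncard_insert_le g {f}
  rw [ncard_singleton] at h3
  omega

lemma circuit_inter_cocircuit_inter_union_subset (h : IsFreeMinor M N T θ C D) (hc : c ∈ C)
    (hd : d ∈ D) (hK : IsParallelCircuit M✶ D c K) (hJ : IsParallelCircuit M C d J)
    (hdK : d ∉ K) : J ∩ K ∩ (C ∪ D) ⊆ {c} := by
  rintro z ⟨⟨hzJ, hzK⟩, hzC | hzD⟩
  · exact (h.dual.inter_right_eq_singleton Subset.rfl hc hK).subset ⟨hzK, hzC⟩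
  · obtain rfl : z = d := (h.inter_right_eq_singleton Subset.rfl hd hJ).subset ⟨hzJ, hzD⟩
    exact absurd hzK hdK

lemma tangleRank_le_ncard_sdiff_singleton (h : IsFreeMinor M N T θ C D) (hJ : M.IsCircuit J)
    (hx : x ∈ J) : tangleRank M T θ J ≤ (J \ {x}).ncard := by
  have h1 := h.tangleRank_lt_ncard_of_dep hJ.dep
  have h2 := ncard_sdiff_singleton_add_one hx (M.set_finite J hJ.subset_ground)
  omega

lemma mem_cocircuit_of_mem_circuit (h : IsFreeMinor M N T θ C D) (hc : c ∈ C) (hd : d ∈ D)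
    (hK : IsParallelCircuit M✶ D c K) (hJ : IsParallelCircuit M C d J) (hcJ : c ∈ J) :
    d ∈ K := by
  by_contra hdK
  have hJK := h.circuit_inter_cocircuit_inter_union_subset hc hd hK hJ hdK
  obtain ⟨z, ⟨hzJ, hzK⟩, hzc⟩ :=
    (hJ.isCircuit.isCocircuit_inter_nontrivial hK.isCircuit ⟨c, hcJ, hK.mem⟩).exists_ne c
  have hz : z ∉ C ∪ D := fun hz ↦ hzc (hJK ⟨⟨hzJ, hzK⟩, hz⟩)
  have hdC : insert d C ⊆ C ∪ D := insert_subset (Or.inr hd) subset_union_left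
  have hcD : insert c D ⊆ C ∪ D := insert_subset (Or.inl hc) subset_union_right
  have hJz := (hJ.sdiff_singleton_subset hzJ (mt (@hdC z) hz)).trans hdC
  have hKz := (hK.sdiff_singleton_subset hzK (mt (@hcD z) hz)).trans hcD
  have hinter : J \ {z} ∩ (K \ {z}) = {c} := by
    refine Subset.antisymm (fun w hw ↦ hJK ⟨⟨hw.1.1, hw.2.1⟩, hJz hw.1⟩) ?_
    exact singleton_subset_iff.2 ⟨⟨hcJ, hzc.symm⟩, hK.mem, hzc.symm⟩
  have hJrank := h.tangleRank_le_ncard_sdiff_singleton hJ.isCircuit hzJ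
  have hKrank := h.dual.tangleRank_le_ncard_sdiff_singleton hK.isCircuit hzK
  rw [h.isTangle.tangleRank_dual] at hKrank
  have hle := h.tangleRank_insert_inter_le (x := z) hJz hKz
    (by rwa [insert_sdiff_self_of_mem hzJ]) (by rwa [insert_sdiff_self_of_mem hzK])
  rw [hinter, ncard_singleton] at hle
  have hge := h.isTangle.le_tangleRank h.isKConnected (j := 2) (X := {z, c}) (by norm_num)
    (by have := h.four_le_order; omega) (ncard_pair hzc).ge
  omega

lemma mem_circuit_iff_mem_cocircuit (h : IsFreeMinor M N T θ C D) (hc : c ∈ C) (hd : d ∈ D)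
    (hK : IsParallelCircuit M✶ D c K) (hJ : IsParallelCircuit M C d J) : c ∈ J ↔ d ∈ K :=
  ⟨h.mem_cocircuit_of_mem_circuit hc hd hK hJ,
    h.dual.mem_cocircuit_of_mem_circuit hd hc (by rwa [Matroid.dual_dual]) hK⟩

lemma exists_parallelCircuit_of_dep (h : IsFreeMinor M N T θ C D) (hC₁ : C₁ ⊆ C)
    (hX : (M ／ C₁ ＼ D₁).Dep X) (hXCD : (X ∩ (C ∪ D)).Subsingleton)
    (hX' : (X \ (C ∪ D)).Subsingleton) :
    ∃ d ∈ D \ D₁, ∃ J, IsParallelCircuit M C₁ d J := by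
  rw [Matroid.delete_dep_iff] at hX
  obtain ⟨J, hJX, hJ⟩ := (hX.1.of_contract (hC₁.trans h.left_subset)).exists_isCircuit_subset
  have hJC₁ : J \ C₁ ⊆ X := sdiff_subset_iff.2 hJX
  have hJD : ¬ Disjoint J D := by
    intro hJD
    have hsub : J \ C ⊆ X \ (C ∪ D) := fun z hz ↦
      ⟨hJC₁ ⟨hz.1, fun hzC ↦ hz.2 (hC₁ hzC)⟩, fun hzCD ↦ hzCD.elim hz.2 (disjoint_left.1 hJD hz.1)⟩
    have h1 := h.three_le_ncard_circuit_sdiff hJ hJD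
    have h2 := subsingleton_ncard_le_one (hX'.anti hsub)
    omega
  obtain ⟨d, hdJ, hdD⟩ := not_disjoint_iff.1 hJD
  have hdX : d ∈ X := hJC₁ ⟨hdJ, fun hdC ↦ h.disjoint.le_bot ⟨hC₁ hdC, hdD⟩⟩
  refine ⟨d, ⟨hdD, disjoint_left.1 hX.2 hdX⟩, J, hJ, hdJ, hX'.anti fun z ⟨hzJ, hz⟩ ↦ ?_⟩
  rw [mem_insert_iff, not_or] at hz
  have hzX : z ∈ X := hJC₁ ⟨hzJ, hz.2⟩
  exact ⟨hzX, fun hzCD ↦ hz.1 (hXCD ⟨hzX, hzCD⟩ ⟨hdX, Or.inr hdD⟩)⟩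

lemma ncard_inter_le_conn (h : IsFreeMinor M N T θ C D) (hC₁ : C₁ ⊆ C) (hD₁ : D₁ ⊆ D)
    (hX : X ⊆ M.E \ (C₁ ∪ D₁)) (hX' : (X \ (C ∪ D)).ncard + 2 ≤ θ) :
    (X ∩ (C ∪ D)).ncard ≤ conn (M ／ C₁ ＼ D₁) X := by
  have hCD := h.union_subset_ground
  have hsub : C₁ ∪ D₁ ⊆ C ∪ D := union_subset_union hC₁ hD₁
  obtain ⟨hXE, hdisj⟩ := subset_sdiff.1 hX
  have hcard : (X ∪ (C₁ ∪ D₁)).ncard ≤ (C ∪ D).ncard + (X \ (C ∪ D)).ncard := by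
    refine (ncard_le_ncard ?_ ?_).trans (ncard_union_le _ _)
    · rw [union_sdiff_self]
      exact union_subset subset_union_right (hsub.trans subset_union_left)
    · exact (M.set_finite _ hCD).union (M.set_finite X hXE).sdiff
  have h1 := conn_union_le_conn_contract_delete_add M hX (hC₁.trans h.left_subset)
    (hD₁.trans h.right_subset) (h.disjoint.mono hC₁ hD₁)
  have h2 := h.isTangle.tangleRank_le_conn_of_ncard_le (union_subset hXE (hsub.trans hCD))
    (by have := h.ncard_le; omega)
  have h3 := h.isTangle.tangleRank_mono
    (union_subset_union_left (C₁ ∪ D₁) (inter_subset_left : X ∩ (C ∪ D) ⊆ X))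
  have h4 := h.ncard_le_tangleRank (union_subset inter_subset_right hsub : X ∩ (C ∪ D) ∪ _ ⊆ _)
  rw [ncard_union_eq (hdisj.mono_left inter_subset_left)
    ((M.set_finite X hXE).inter_of_left _) (M.set_finite _ (hsub.trans hCD))] at h4
  omega

lemma exists_parallelCircuit_of_conn_lt (h : IsFreeMinor M N T θ C D) (hC₁ : C₁ ⊆ C)
    (hD₁ : D₁ ⊆ D) (hX : X ⊆ M.E \ (C₁ ∪ D₁)) (hX' : (X \ (C ∪ D)).ncard ≤ 1)
    (h2 : conn (M ／ C₁ ＼ D₁) X < 2) (hlt : conn (M ／ C₁ ＼ D₁) X < X.ncard) :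
    (∃ d ∈ D \ D₁, ∃ J, IsParallelCircuit M C₁ d J) ∨
      ∃ c ∈ C \ C₁, ∃ K, IsParallelCircuit M✶ D₁ c K := by
  have hXfin := M.set_finite X (hX.trans sdiff_subset)
  have := hXfin.to_subtype
  have hXCD : (X ∩ (C ∪ D)).ncard ≤ 1 := by
    have := h.ncard_inter_le_conn hC₁ hD₁ hX (by have := h.four_le_order; omega)
    omega
  rw [ncard_le_one_iff_subsingleton] at hXCD hX'
  rw [← contract_delete_ground] at hX
  by_cases hr : rk (M ／ C₁ ＼ D₁) X < X.ncard
  · exact Or.inl (h.exists_parallelCircuit_of_dep hC₁ ((rk_lt_ncard_iff_dep _ hX).1 hr) hXCD hX')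
  · have hadd := conn_add_ncard _ hX
    have hdep := (rk_lt_ncard_iff_dep (M ／ C₁ ＼ D₁)✶ hX).1 (by omega)
    rw [Matroid.contract_delete_comm _ (h.disjoint.mono hC₁ hD₁),
      Matroid.dual_delete_contract] at hdep
    rw [union_comm] at hXCD hX'
    exact Or.inr (h.dual.exists_parallelCircuit_of_dep hD₁ hdep hXCD hX')

omit [M.Finite] in
lemma minor_eq (h : IsFreeMinor M N T θ C D) (hC₁ : C₁ ⊆ C) (hD₁ : D₁ ⊆ D) :
    M ／ C₁ ＼ D₁ ／ (C \ C₁) ＼ (D \ D₁) = M ／ C ＼ D := by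
  rw [Matroid.contract_delete_contract_delete _ _ _ _ _ (h.disjoint.mono sdiff_subset hD₁),
    union_sdiff_cancel hC₁, union_sdiff_cancel hD₁]

lemma ncard_sdiff_le_one_or_of_conn_lt (h : IsFreeMinor M N T θ C D) (hC₁ : C₁ ⊆ C)
    (hD₁ : D₁ ⊆ D) (hX : X ⊆ M.E \ (C₁ ∪ D₁)) (hlt : conn (M ／ C₁ ＼ D₁) X < 2) :
    (X \ (C ∪ D)).ncard ≤ 1 ∨ (((M.E \ (C₁ ∪ D₁)) \ X) \ (C ∪ D)).ncard ≤ 1 := by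
  by_contra! hgt
  have h1 := conn_contract_delete_le (M ／ C₁ ＼ D₁) (C \ C₁) (D \ D₁)
    (contract_delete_ground M C₁ D₁ ▸ hX)
  rw [h.minor_eq hC₁ hD₁, show X \ (C \ C₁ ∪ D \ D₁) = X \ (C ∪ D) by tauto_set] at h1
  have h2 := isKConnected_iff.1 h.isKConnected_minor 2 (by norm_num) (X \ (C ∪ D))
    (by rw [contract_delete_ground]; exact sdiff_subset_sdiff_left (hX.trans sdiff_subset))
    hgt.1 (hgt.2.trans_le (ncard_le_ncard ?_ (M ／ C ＼ D).ground_finite.sdiff))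
  · omega
  · rw [contract_delete_ground]
    tauto_set

lemma exists_parallelCircuit_of_not_isKConnected (h : IsFreeMinor M N T θ C D) (hC₁ : C₁ ⊆ C)
    (hD₁ : D₁ ⊆ D) (hnot : ¬ IsKConnected (M ／ C₁ ＼ D₁) 3) :
    (∃ d ∈ D \ D₁, ∃ J, IsParallelCircuit M C₁ d J) ∨
      ∃ c ∈ C \ C₁, ∃ K, IsParallelCircuit M✶ D₁ c K := by
  simp only [isKConnected_iff, not_forall, not_le] at hnot
  obtain ⟨j, hj, X, hX, h1, h2, hlt⟩ := hnot
  have hcompl := conn_compl _ hX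
  rw [contract_delete_ground] at hX h2 hcompl
  rcases h.ncard_sdiff_le_one_or_of_conn_lt hC₁ hD₁ hX (by omega) with hX' | hX'
  · exact h.exists_parallelCircuit_of_conn_lt hC₁ hD₁ hX hX' (by omega) (by omega)
  · exact h.exists_parallelCircuit_of_conn_lt hC₁ hD₁ (X := (M.E \ (C₁ ∪ D₁)) \ X) sdiff_subset hX'
      (by omega) (by omega)

lemma isKConnected_contract (h : IsFreeMinor M N T θ C D) (hC₁ : C₁ ⊆ C)
    (hno : ∀ d ∈ D, ∀ J, ¬ IsParallelCircuit M C₁ d J) : IsKConnected (M ／ C₁) 3 := by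
  by_contra hnot
  rw [← (M ／ C₁).delete_empty] at hnot
  rcases h.exists_parallelCircuit_of_not_isKConnected hC₁ (empty_subset D) hnot with
    ⟨d, hd, J, hJ⟩ | ⟨c, -, K, hK⟩
  · exact hno d hd.1 J hJ
  · have h1 := h.dual.three_le_ncard_circuit hK.isCircuit
    have h2 := subsingleton_ncard_le_one hK.sdiff_subsingleton
    have h3 := ncard_le_ncard_sdiff_add_ncard K (insert c ∅)
    rw [insert_empty_eq, ncard_singleton] at *
    omega

end IsFreeMinor

section Exchange

namespace IsFreeMinor

variable [M.Finite]

lemma isCircuit_pair_of_isCircuit_triangle (h : IsFreeMinor M N T θ C D) (ha : a ∈ C) (hb : b ∈ D)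
    (hx : x ∉ C ∪ D) (hJ : M.IsCircuit {a, b, x}) : (M ／ C ＼ (D \ {b})).IsCircuit {b, x} := by
  have hbC : b ∉ C := fun hbC ↦ h.disjoint.le_bot ⟨hbC, hb⟩
  have hxC : x ∉ C := fun hxC ↦ hx (Or.inl hxC)
  have hxD : x ∉ D := fun hxD ↦ hx (Or.inr hxD)
  have hbx : b ≠ x := fun hbx ↦ hxD (hbx ▸ hb)
  have hJC : ({a, b, x} : Set α) \ C = {b, x} := by
    rw [insert_sdiff_of_mem _ ha, sdiff_eq_left]
    exact disjoint_insert_left.2 ⟨hbC, disjoint_singleton_left.2 hxC⟩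
  have hdep : (M ／ C ＼ (D \ {b})).Dep {b, x} := by
    rw [Matroid.delete_dep_iff, ← hJC]
    refine ⟨hJ.contract_dep_of_not_subset fun hs ↦ hxC (hs (by simp)), ?_⟩
    rw [hJC, disjoint_insert_left, disjoint_singleton_left]
    exact ⟨fun hbD ↦ hbD.2 rfl, fun hxD' ↦ hxD hxD'.1⟩
  have hb_indep : ¬ (M ／ C ＼ (D \ {b})).Dep {b} := fun hb' ↦
    (Matroid.delete_dep_iff.1 hb').1.of_contract h.left_subset |>.not_indep <|
      h.indep (union_subset subset_union_left (singleton_subset_iff.2 (Or.inr hb)))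
  have hx_indep : ¬ (M ／ C ＼ (D \ {b})).Dep {x} := fun hx' ↦ by
    have h3 := h.isKConnected_minor.le_ncard_of_dep (X := {x})
      (by have := h.four_le_ncard_compl; rw [contract_delete_ground]; omega)
      (Matroid.delete_dep_iff.2
        ⟨(Matroid.delete_dep_iff.1 hx').1, disjoint_singleton_left.2 hxD⟩)
    simp at h3
  rw [Matroid.isCircuit_iff_dep_forall_sdiff_singleton_indep]
  refine ⟨hdep, ?_⟩
  rintro e (rfl | rfl)
  · rw [pair_sdiff_left hbx]
    exact (Matroid.not_dep_iff (subset_trans (by simp) hdep.subset_ground)).1 hx_indep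
  · rw [pair_sdiff_right hbx]
    exact (Matroid.not_dep_iff (subset_trans (by simp) hdep.subset_ground)).1 hb_indep

lemma tangleRank_triangle_le (h : IsFreeMinor M N T θ C D) (hJ : M.IsCircuit {a, b, x}) :
    tangleRank M T θ {a, b, x} ≤ 2 := by
  have h1 := h.tangleRank_lt_ncard_of_dep hJ.dep
  have h2 := ncard_insert_le a {b, x}
  have h3 := ncard_insert_le b {x}
  rw [ncard_singleton] at h3
  omega

lemma third_notMem_of_isCircuit_triangle (h : IsFreeMinor M N T θ C D) (ha : a ∈ C) (hb : b ∈ D)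
    (hJ : M.IsCircuit {a, b, x}) : x ∉ C ∪ D := fun hx ↦
  hJ.not_indep (h.indep (insert_subset (Or.inl ha)
    (insert_subset (Or.inr hb) (singleton_subset_iff.2 hx))))

lemma third_notMem_ground_of_isCircuit_triangle (h : IsFreeMinor M N T θ C D) (ha : a ∈ C)
    (hb : b ∈ D) (hJ : M.IsCircuit {a, b, x}) : x ∉ N.E := by
  intro hxN
  have hab : a ≠ b := fun hab ↦ h.disjoint.le_bot ⟨ha, hab ▸ hb⟩
  have hsub := h.isTangle.tangleRank_inter_add_tangleRank_union_le N.E {a, b, x}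
  have hinter := h.isTangle.tangleRank_mono
    (singleton_subset_iff.2 ⟨hxN, by simp⟩ : {x} ⊆ N.E ∩ {a, b, x})
  have hone := h.isTangle.le_tangleRank h.isKConnected (j := 1) (X := {x}) (by norm_num)
    (by have := h.four_le_order; omega) (ncard_singleton x).ge
  have hunion := h.isTangle.tangleRank_mono
    (union_subset_union_right N.E (show {a, b} ⊆ ({a, b, x} : Set α) from
      insert_subset_insert (singleton_subset_iff.2 (mem_insert b {x}))))
  rw [h.tangleRank_union (insert_subset (Or.inl ha) (singleton_subset_iff.2 (Or.inr hb))),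
    ncard_pair hab] at hunion
  have hle := h.tangleRank_triangle_le hJ
  omega

lemma tangleRank_exchange (h : IsFreeMinor M N T θ C D) (ha : a ∈ C) (hb : b ∈ D)
    (hJ : M.IsCircuit {a, b, x}) :
    tangleRank M T θ (N.E ∪ C ∪ insert x (D \ {b})) =
      tangleRank M T θ N.E + (C ∪ insert x (D \ {b})).ncard := by
  have hx := h.third_notMem_of_isCircuit_triangle ha hb hJ
  have hbC : b ∉ C := fun hbC ↦ h.disjoint.le_bot ⟨hbC, hb⟩
  have hax : a ≠ x := fun hax ↦ hx (hax ▸ Or.inl ha)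
  have hCD : C ∪ insert x (D \ {b}) = insert x ((C ∪ D) \ {b}) := by
    rw [union_insert, union_sdiff_distrib, sdiff_singleton_eq_self hbC]
  have hcard : (C ∪ insert x (D \ {b})).ncard = (C ∪ D).ncard := by
    rw [hCD, ncard_exchange hx (Or.inr hb)]
  have hupper := h.isTangle.tangleRank_union_le_add_ncard N.E (Y := C ∪ insert x (D \ {b}))
    (hCD ▸ insert_subset (hJ.subset_ground (by simp)) (sdiff_subset.trans h.union_subset_ground))
  rw [← union_assoc] at hupper
  have hsub := h.isTangle.tangleRank_inter_add_tangleRank_union_le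
    (N.E ∪ C ∪ insert x (D \ {b})) {a, b, x}
  have hinter := h.isTangle.tangleRank_mono
    (show {a, x} ⊆ (N.E ∪ C ∪ insert x (D \ {b})) ∩ {a, b, x} by grind)
  have htwo := h.isTangle.le_tangleRank h.isKConnected (j := 2) (X := {a, x}) (by norm_num)
    (by have := h.four_le_order; omega) (ncard_pair hax).ge
  have hunion := h.isTangle.tangleRank_mono
    (show N.E ∪ C ∪ D ⊆ (N.E ∪ C ∪ insert x (D \ {b})) ∪ {a, b, x} by
      rintro z (hz | hz)
      · exact Or.inl (Or.inl hz)
      · by_cases hzb : z = b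
        · exact Or.inr (Or.inr (Or.inl hzb))
        · exact Or.inl (Or.inr (Or.inr ⟨hz, hzb⟩)))
  rw [h.rank_eq] at hunion
  have hle := h.tangleRank_triangle_le hJ
  omega

lemma exchange (h : IsFreeMinor M N T θ C D) (ha : a ∈ C) (hb : b ∈ D)
    (hJ : M.IsCircuit {a, b, x}) : IsFreeMinor M N T θ C (insert x (D \ {b})) := by
  have hx := h.third_notMem_of_isCircuit_triangle ha hb hJ
  have hbx : b ≠ x := fun hbx ↦ hx (hbx ▸ Or.inr hb)
  have hbC : b ∉ C := fun hbC ↦ h.disjoint.le_bot ⟨hbC, hb⟩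
  have hpair := h.isCircuit_pair_of_isCircuit_triangle ha hb hx hJ
  have hDb : M ／ C ＼ (D \ {b}) ＼ {b} = M ／ C ＼ D := by
    rw [Matroid.delete_delete, sdiff_union_of_subset (singleton_subset_iff.2 hb)]
  have hDx : M ／ C ＼ (D \ {b}) ＼ {x} = M ／ C ＼ (insert x (D \ {b})) := by
    rw [Matroid.delete_delete, union_singleton]
  exact {
    isKConnected := h.isKConnected
    isTangle := h.isTangle
    left_subset := h.left_subset
    right_subset := insert_subset (hJ.subset_ground (by simp)) (sdiff_subset.trans h.right_subset)
    disjoint := disjoint_insert_right.2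
      ⟨fun hxC ↦ hx (Or.inl hxC), h.disjoint.mono_right sdiff_subset⟩
    isKConnected_minor :=
      hDx ▸ IsKConnected.delete_of_parallel hbx hpair (hDb ▸ h.isKConnected_minor)
    isMinor := hDx ▸ isMinor_delete_of_parallel hbx hpair (hDb ▸ h.isMinor)
      (h.third_notMem_ground_of_isCircuit_triangle ha hb hJ)
    rank_eq := h.tangleRank_exchange ha hb hJ
    four_le := by
      rw [union_insert, ← sdiff_singleton_eq_self hbC, ← union_sdiff_distrib,
        ncard_exchange hx (Or.inr hb)]
      exact h.four_le }

end IsFreeMinor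

end Exchange

/-! ### Fans -/

/-- `F` behaves in the tangle like a fan of `M` ending with a triad `{a, b, w}`: it is a small set
of connectivity at most 2, and so is `F \ {a}`. Fans ending with a triangle are the fan ends of
`M✶`. -/
structure IsFanEnd (M : Matroid α) (T : Set (Set α)) (a b : α) (F : Set α) : Prop where
  left_mem : a ∈ F
  right_mem : b ∈ F
  exists_triad : ∃ w ∈ F, M✶.IsCircuit {a, b, w}
  mem : F ∈ T
  conn_le : conn M F ≤ 2
  conn_sdiff_le : conn M (F \ {a}) ≤ 2

/-- A fan end that no triangle through `a` extends. -/
structure IsMaxFanEnd (M : Matroid α) (T : Set (Set α)) (a b : α) (F : Set α) : Prop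
    extends IsFanEnd M T a b F where
  ncard_ne : ∀ J, M.IsCircuit J → a ∈ J → J.ncard ≠ 3

lemma conn_sdiff_singleton_eq [M.Finite] (hX : X ⊆ M.E) (hxX : x ∈ X)
    (hx : x ∈ M.closure (X \ {x})) (hx' : x ∈ M✶.closure (X \ {x})) :
    conn M (X \ {x}) = conn M X + 1 := by
  have h1 := rk_insert_of_mem_closure M hx
  have h2 := rk_insert_of_mem_closure M✶ hx'
  have h3 := conn_add_ncard M hX
  have h4 := conn_add_ncard M (sdiff_subset.trans hX : X \ {x} ⊆ M.E)
  have h5 := ncard_sdiff_singleton_add_one hxX (M.set_finite X)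
  rw [insert_sdiff_self_of_mem hxX] at h1 h2
  omega

lemma isParallelCircuit_triangle (hbC : b ∈ C) (hJ : M.IsCircuit {a, b, x}) :
    IsParallelCircuit M C a {a, b, x} where
  isCircuit := hJ
  mem := mem_insert a _
  sdiff_subsingleton := (subsingleton_singleton (a := x)).anti (by grind)

namespace IsFreeMinor

variable [M.Finite] {F : Set α}

lemma circuit_not_subset_fan (h : IsFreeMinor M N T θ C D) (hF : IsFanEnd M T a b F)
    (hJ : M.IsCircuit J) (haJ : a ∈ J) : ¬ J ⊆ F := by
  intro hJF
  obtain ⟨w, hwF, hK⟩ := hF.exists_triad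
  have hKF : {a, b, w} ⊆ F :=
    insert_subset hF.left_mem (insert_subset hF.right_mem (singleton_subset_iff.2 hwF))
  have hFE := h.isTangle.subset_ground F hF.mem
  have hconn := conn_sdiff_singleton_eq hFE hF.left_mem
    (M.closure_subset_closure (sdiff_subset_sdiff_left hJF)
      (hJ.mem_closure_sdiff_singleton_of_mem haJ))
    (M✶.closure_subset_closure (sdiff_subset_sdiff_left hKF)
      (hK.mem_closure_sdiff_singleton_of_mem (mem_insert a _)))
  have hcard : 2 ≤ F.ncard := by
    have h1 := h.three_le_ncard_circuit hJ
    have h2 := ncard_le_ncard hJF (M.set_finite F)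
    omega
  have hrank := h.isTangle.le_tangleRank h.isKConnected (j := 2) (X := F) (by norm_num)
    (by have := h.four_le_order; omega) hcard
  have h1 := tangleRank_le_conn (M := M) (θ := θ) hF.mem Subset.rfl
  have h2 := hF.conn_sdiff_le
  omega

lemma right_mem_of_triangle (h : IsFreeMinor M N T θ C D) (ha : a ∈ C) (hb : b ∈ D)
    (hF : IsFanEnd M T a b F) (hJ : M.IsCircuit J) (haJ : a ∈ J) (hJ3 : J.ncard = 3) :
    b ∈ J := by
  by_contra hbJ
  obtain ⟨w, hwF, hK⟩ := hF.exists_triad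
  have hwDC : w ∉ D ∪ C :=
    h.dual.third_notMem_of_isCircuit_triangle hb ha (insert_comm a b {w} ▸ hK)
  obtain ⟨x, hxJ, hxF⟩ := not_subset.1 (h.circuit_not_subset_fan hF hJ haJ)
  have hwJ : w ∈ J ∧ w ≠ a := by
    obtain ⟨y, ⟨hyJ, hya | hyb | hyw⟩, hya'⟩ :=
      (hJ.isCocircuit_inter_nontrivial hK ⟨a, haJ, mem_insert a _⟩).exists_ne a
    exacts [absurd hya hya', absurd (hyb ▸ hyJ) hbJ, hyw ▸ ⟨hyJ, hya'⟩]
  have hJeq : {x, a, w} = J := by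
    have hxa : x ≠ a := fun hxa ↦ hxF (hxa ▸ hF.left_mem)
    have hxw : x ≠ w := fun hxw ↦ hxF (hxw ▸ hwF)
    refine eq_of_subset_of_ncard_le ?_ ?_ (M.set_finite J hJ.subset_ground)
    · exact insert_subset hxJ (insert_subset haJ (singleton_subset_iff.2 hwJ.1))
    · rw [hJ3, ncard_eq_three.2 ⟨x, a, w, hxa, hxw, hwJ.2.symm, rfl⟩]
  subst hJeq
  have hxD : x ∉ D := by
    intro hxD
    rcases h.mem_cocircuit_of_mem_circuit ha hxD (isParallelCircuit_triangle hb hK)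
      (isParallelCircuit_triangle ha hJ) haJ with rfl | rfl | rfl
    exacts [hxF hF.left_mem, hxF hF.right_mem, hxF hwF]
  have hJD : Disjoint {x, a, w} D := by
    simp only [disjoint_insert_left, disjoint_singleton_left]
    exact ⟨hxD, fun haD ↦ h.disjoint.le_bot ⟨ha, haD⟩, fun hwD ↦ hwDC (Or.inl hwD)⟩
  have h3 := h.three_le_ncard_circuit_sdiff hJ hJD
  have h2 := ncard_le_ncard (show {x, a, w} \ C ⊆ {x, w} by grind)
  have hpair := ncard_insert_le x {w}
  rw [ncard_singleton] at hpair
  omega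

lemma exists_eq_triangle (h : IsFreeMinor M N T θ C D) (ha : a ∈ C) (hb : b ∈ D)
    (hF : IsFanEnd M T a b F) (hJ : M.IsCircuit J) (haJ : a ∈ J) (hJ3 : J.ncard = 3) :
    ∃ x ∉ F, J = {a, b, x} := by
  have hab : a ≠ b := fun hab ↦ h.disjoint.le_bot ⟨ha, hab ▸ hb⟩
  obtain ⟨x, hxJ, hxF⟩ := not_subset.1 (h.circuit_not_subset_fan hF hJ haJ)
  have hax : a ≠ x := fun hax ↦ hxF (hax ▸ hF.left_mem)
  have hbx : b ≠ x := fun hbx ↦ hxF (hbx ▸ hF.right_mem)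
  have hbJ := h.right_mem_of_triangle ha hb hF hJ haJ hJ3
  refine ⟨x, hxF, (eq_of_subset_of_ncard_le ?_ ?_ (M.set_finite J hJ.subset_ground)).symm⟩
  · exact insert_subset haJ (insert_subset hbJ (singleton_subset_iff.2 hxJ))
  · rw [hJ3, ncard_eq_three.2 ⟨a, b, x, hab, hax, hbx, rfl⟩]

end IsFreeMinor

lemma IsFanEnd.extend [M.Finite] {F : Set α} (hF : IsFanEnd M T a b F) (hT : IsTangle M T θ)
    (hθ : 3 ≤ θ) (hJ : M.IsCircuit {a, b, x}) (hxF : x ∉ F) :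
    IsFanEnd M✶ T x a (insert x F) := by
  have hFE := hT.subset_ground F hF.mem
  have hxE : x ∈ M.E := hJ.subset_ground (by simp)
  have hx : x ∈ M.closure F := (Matroid.mem_closure_iff_exists_isCircuit hxF).2 ⟨_, by
    have := hF.left_mem
    have := hF.right_mem
    grind, hJ, by simp⟩
  have hconn : conn M (insert x F) ≤ 2 := by
    have h1 := rk_insert_of_mem_closure M hx
    have h2 := rk_mono M (sdiff_subset_sdiff_right (subset_insert x F) : M.E \ insert x F ⊆ M.E \ F)
    have h3 := conn_add M F
    have h4 := conn_add M (insert x F)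
    have h5 := hF.conn_le
    omega
  have hx_mem : {x} ∈ T :=
    hT.mem_of_ncard_lt (singleton_subset_iff.2 hxE) (by rw [ncard_singleton]; omega)
  exact {
    left_mem := mem_insert x F
    right_mem := Or.inr hF.left_mem
    exists_triad := ⟨b, Or.inr hF.right_mem, by
      rwa [Matroid.dual_dual, insert_comm, pair_comm]⟩
    mem := by
      rw [← singleton_union] at hconn ⊢
      exact hT.union_mem hx_mem hF.mem (by omega)
    conn_le := by rwa [conn_dual M (insert_subset hxE hFE)]
    conn_sdiff_le := by
      rw [insert_sdiff_self_of_notMem hxF, conn_dual M hFE]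
      exact hF.conn_le }

section FanSystem

variable {ι : Type*} {i : ι} {f : ι → α}

lemma injective_update [DecidableEq ι] (hf : f.Injective) (hx : x ∉ range f) :
    (Function.update f i x).Injective := by
  intro j k hjk
  by_cases hj : j = i <;> by_cases hk : k = i
  · rw [hj, hk]
  · subst hj
    rw [Function.update_self, Function.update_of_ne hk] at hjk
    exact absurd ⟨k, hjk.symm⟩ hx
  · subst hk
    rw [Function.update_self, Function.update_of_ne hj] at hjk
    exact absurd ⟨j, hjk⟩ hx
  · rw [Function.update_of_ne hk, Function.update_of_ne hj] at hjk
    exact hf hjk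

lemma insert_range_sdiff_singleton [DecidableEq ι] (hf : f.Injective) :
    insert x (range f \ {f i}) = range (Function.update f i x) := by
  ext z
  constructor
  · rintro (rfl | ⟨⟨j, rfl⟩, hji⟩)
    · exact ⟨i, Function.update_self ..⟩
    · exact ⟨j, Function.update_of_ne (fun hj ↦ hji (congrArg f hj)) _ _⟩
  · rintro ⟨j, rfl⟩
    by_cases hj : j = i
    · subst hj
      exact Or.inl (Function.update_self ..)
    · rw [Function.update_of_ne hj]
      exact Or.inr ⟨⟨j, rfl⟩, fun hji ↦ hj (hf hji)⟩

/-- A free minor `M ／ C ＼ D` in which the elements of `C` and `D` outside `C₀` and `D₀` are paired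
up by fan ends, of `M` or of `M✶`. -/
structure IsFanSystem (M N : Matroid α) (T : Set (Set α)) (θ : ℕ) (C₀ D₀ : Set α) (a b : ι → α)
    (F : ι → Set α) : Prop where
  free : IsFreeMinor M N T θ (C₀ ∪ range a) (D₀ ∪ range b)
  left_injective : a.Injective
  right_injective : b.Injective
  left_notMem : ∀ i, a i ∉ C₀
  right_notMem : ∀ i, b i ∉ D₀
  fan : ∀ i, IsFanEnd M T (a i) (b i) (F i) ∨ IsFanEnd M✶ T (b i) (a i) (F i)

/-- Contracting `C'` keeps `M` 3-connected with `N` as a minor, and `C'` is free over `E(N)` in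
the tangle matroid: the first outcome of the theorem, apart from the size of `C'`. The second
outcome is this one for `M✶` and `N✶`. -/
structure IsFreeContraction (M N : Matroid α) (T : Set (Set α)) (θ : ℕ) (C' : Set α) : Prop where
  subset_ground : C' ⊆ M.E
  rank_eq : tangleRank M T θ (N.E ∪ C') = tangleRank M T θ N.E + C'.ncard
  isKConnected : IsKConnected (M ／ C') 3
  isMinor : N ≤m M ／ C'

/-- `C'` is a subset of `C₀` whose elements are in series with other elements in `M ＼ D₀`, and
whose contraction makes no element of `D₀` parallel to another element. Such sets can be contracted
together with the ends of maximal fans. -/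
structure IsSafe (M : Matroid α) (C₀ D₀ C' : Set α) : Prop where
  subset : C' ⊆ C₀
  exists_cocircuit : ∀ c ∈ C', ∃ K, IsParallelCircuit M✶ D₀ c K
  not_isParallelCircuit : ∀ d ∈ D₀, ∀ J, ¬ IsParallelCircuit M C' d J

variable {C₀ D₀ C' : Set α} {a b : ι → α} {F : ι → Set α} {S : Set ι} [M.Finite]

lemma IsFreeMinor.isFreeContraction (h : IsFreeMinor M N T θ C D) (hC₁ : C₁ ⊆ C)
    (hno : ∀ d ∈ D, ∀ J, ¬ IsParallelCircuit M C₁ d J) : IsFreeContraction M N T θ C₁ where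
  subset_ground := hC₁.trans h.left_subset
  rank_eq := h.tangleRank_union (hC₁.trans subset_union_left)
  isKConnected := h.isKConnected_contract hC₁ hno
  isMinor := h.isMinor.trans ⟨C \ C₁, D, by
    rw [Matroid.contract_contract, union_sdiff_cancel hC₁]⟩

lemma IsFreeContraction.of_dual (hT : IsTangle M T θ)
    (h : IsFreeContraction M✶ N✶ T θ D) : D ⊆ M.E ∧
      tangleRank M T θ (N.E ∪ D) = tangleRank M T θ N.E + D.ncard ∧
      IsKConnected (M ＼ D) 3 ∧ N ≤m M ＼ D := by
  refine ⟨h.subset_ground, ?_, ?_, ?_⟩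
  · have := h.rank_eq
    rwa [hT.tangleRank_dual, hT.tangleRank_dual] at this
  · rw [← isKConnected_dual_iff, Matroid.dual_delete]
    exact h.isKConnected
  · simpa only [Matroid.dual_contract, Matroid.dual_dual] using isMinor_dual h.isMinor

namespace IsFanSystem

lemma dual (h : IsFanSystem M N T θ C₀ D₀ a b F) :
    IsFanSystem M✶ N✶ T θ D₀ C₀ b a F where
  free := h.free.dual
  left_injective := h.right_injective
  right_injective := h.left_injective
  left_notMem := h.right_notMem
  right_notMem := h.left_notMem
  fan i := by
    rw [Matroid.dual_dual]
    exact (h.fan i).symm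

lemma of_dual (h : IsFanSystem M✶ N✶ T θ D₀ C₀ b a F) : IsFanSystem M N T θ C₀ D₀ a b F := by
  simpa only [Matroid.dual_dual] using h.dual

lemma extend [DecidableEq ι] (h : IsFanSystem M N T θ C₀ D₀ a b F)
    (hF : IsFanEnd M T (a i) (b i) (F i)) (hJ : M.IsCircuit {a i, b i, x}) (hxF : x ∉ F i) :
    IsFanSystem M N T θ C₀ D₀ a (Function.update b i x)
      (Function.update F i (insert x (F i))) := by
  have hx := h.free.third_notMem_of_isCircuit_triangle (Or.inr (mem_range_self i))
    (Or.inr (mem_range_self i)) hJ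
  have hD : insert x ((D₀ ∪ range b) \ {b i}) = D₀ ∪ range (Function.update b i x) := by
    rw [union_sdiff_distrib, sdiff_singleton_eq_self (h.right_notMem i), ← union_insert,
      insert_range_sdiff_singleton h.right_injective]
  exact {
    free := hD ▸ h.free.exchange (Or.inr (mem_range_self i)) (Or.inr (mem_range_self i)) hJ
    left_injective := h.left_injective
    right_injective := injective_update h.right_injective fun hxb ↦ hx (Or.inr (Or.inr hxb))
    left_notMem := h.left_notMem
    right_notMem j := by
      by_cases hj : j = i
      · subst hj
        rw [Function.update_self]
        exact fun hxD ↦ hx (Or.inr (Or.inl hxD))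
      · rw [Function.update_of_ne hj]
        exact h.right_notMem j
    fan j := by
      by_cases hj : j = i
      · subst hj
        rw [Function.update_self, Function.update_self]
        exact Or.inr (hF.extend h.free.isTangle (by have := h.free.four_le_order; omega) hJ hxF)
      · rw [Function.update_of_ne hj, Function.update_of_ne hj]
        exact h.fan j }

omit [M.Finite] in
lemma fan_subset_ground (h : IsFanSystem M N T θ C₀ D₀ a b F) (i : ι) : F i ⊆ M.E :=
  (h.fan i).elim (fun hF ↦ h.free.isTangle.subset_ground _ hF.mem)
    (fun hF ↦ h.free.isTangle.subset_ground _ hF.mem)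

lemma exists_sum_ncard_lt_of_not_isMaxFanEnd [Fintype ι] (h : IsFanSystem M N T θ C₀ D₀ a b F)
    (hF : IsFanEnd M T (a i) (b i) (F i)) (hnot : ¬ IsMaxFanEnd M T (a i) (b i) (F i)) :
    ∃ (b' : ι → α) (F' : ι → Set α), IsFanSystem M N T θ C₀ D₀ a b' F' ∧
      ∑ j, (F j).ncard < ∑ j, (F' j).ncard := by
  classical
  obtain ⟨J, hJ, haJ, hJ3⟩ : ∃ J, M.IsCircuit J ∧ a i ∈ J ∧ J.ncard = 3 := by
    by_contra! hno
    exact hnot ⟨hF, hno⟩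
  obtain ⟨x, hxF, rfl⟩ := h.free.exists_eq_triangle (Or.inr (mem_range_self i))
    (Or.inr (mem_range_self i)) hF hJ haJ hJ3
  refine ⟨_, _, h.extend hF hJ hxF, Finset.sum_lt_sum (fun j _ ↦ ?_) ⟨i, Finset.mem_univ i, ?_⟩⟩
  · by_cases hj : j = i
    · subst hj
      rw [Function.update_self]
      exact ncard_le_ncard_insert _ _
    · rw [Function.update_of_ne hj]
  · rw [Function.update_self, ncard_insert_of_notMem hxF (M.set_finite _ (h.fan_subset_ground i))]
    exact Nat.lt_succ_self _

lemma exists_isMaxFanEnd [Finite ι] (h : IsFanSystem M N T θ C₀ D₀ a b F) :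
    ∃ (a' b' : ι → α) (F' : ι → Set α), IsFanSystem M N T θ C₀ D₀ a' b' F' ∧
      ∀ i, IsMaxFanEnd M T (a' i) (b' i) (F' i) ∨ IsMaxFanEnd M✶ T (b' i) (a' i) (F' i) := by
  have := Fintype.ofFinite ι
  by_contra! hno
  have hlarge (n : ℕ) : ∃ (a' b' : ι → α) (F' : ι → Set α),
      IsFanSystem M N T θ C₀ D₀ a' b' F' ∧ n ≤ ∑ j, (F' j).ncard := by
    induction n with
    | zero => exact ⟨a, b, F, h, Nat.zero_le _⟩
    | succ n ih =>
      obtain ⟨a', b', F', h', hn⟩ := ih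
      obtain ⟨i, hi, hi'⟩ := hno a' b' F' h'
      rcases h'.fan i with hF | hF
      · obtain ⟨b'', F'', h'', hlt⟩ := h'.exists_sum_ncard_lt_of_not_isMaxFanEnd hF hi
        exact ⟨a', b'', F'', h'', hn.trans_lt hlt⟩
      · obtain ⟨a'', F'', h'', hlt⟩ := h'.dual.exists_sum_ncard_lt_of_not_isMaxFanEnd hF hi'
        exact ⟨a'', b', F'', h''.of_dual, hn.trans_lt hlt⟩
  obtain ⟨a', b', F', h', hn⟩ := hlarge (∑ _j : ι, M.E.ncard + 1)
  have hbound : ∑ j, (F' j).ncard ≤ ∑ _j : ι, M.E.ncard :=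
    Finset.sum_le_sum fun j _ ↦ ncard_le_ncard (h'.fan_subset_ground j) M.ground_finite
  omega

lemma mem_right_of_mem_safe (h : IsFanSystem M N T θ C₀ D₀ a b F) (hC' : IsSafe M C₀ D₀ C')
    (hd : d ∈ D₀ ∪ range b) (hJ : IsParallelCircuit M (C₀ ∪ range a) d J) (hc : c ∈ C')
    (hcJ : c ∈ J) : d ∈ D₀ := by
  have hcC : c ∈ C₀ ∪ range a := Or.inl (hC'.subset hc)
  obtain ⟨K, hK⟩ := hC'.exists_cocircuit c hc
  obtain ⟨g, hg, hKg⟩ := h.free.dual.exists_sdiff_eq_singleton subset_union_left hcC hK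
  have hdK := h.free.mem_cocircuit_of_mem_circuit hcC hd (hK.mono subset_union_left) hJ hcJ
  by_contra hdD₀
  have hdc : d ≠ c := fun hdc ↦ h.free.disjoint.le_bot ⟨hcC, hdc ▸ hd⟩
  have hdg : d = g := hKg.subset ⟨hdK, fun hd' ↦ hd'.elim hdc hdD₀⟩
  exact hg (hdg ▸ Or.inl hd)

lemma eq_right_of_left_mem (h : IsFanSystem M N T θ C₀ D₀ a b F)
    (hF : IsFanEnd M T (a i) (b i) (F i)) (hd : d ∈ D₀ ∪ range b)
    (hJ : IsParallelCircuit M (C₀ ∪ range a) d J) (haJ : a i ∈ J) : d = b i := by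
  have ha : a i ∈ C₀ ∪ range a := Or.inr (mem_range_self i)
  have hb : b i ∈ D₀ ∪ range b := Or.inr (mem_range_self i)
  obtain ⟨w, -, hK⟩ := hF.exists_triad
  have hw := h.free.dual.third_notMem_of_isCircuit_triangle hb ha
    (insert_comm (a i) (b i) {w} ▸ hK)
  rcases h.free.mem_cocircuit_of_mem_circuit ha hd (isParallelCircuit_triangle hb hK) hJ haJ with
    rfl | rfl | rfl
  exacts [(h.free.disjoint.le_bot ⟨ha, hd⟩).elim, rfl, absurd (Or.inl hd) hw]

lemma eq_left_of_mem_circuit (h : IsFanSystem M N T θ C₀ D₀ a b F) (hC' : IsSafe M C₀ D₀ C')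
    (hS : ∀ j ∈ S, IsFanEnd M T (a j) (b j) (F j))
    (hJ : IsParallelCircuit M (C' ∪ a '' S) (b i) J) (hxJ : x ∈ J) (hx : x ∈ C' ∪ a '' S) :
    i ∈ S ∧ x = a i := by
  have hb : b i ∈ D₀ ∪ range b := Or.inr (mem_range_self i)
  have hJ' := hJ.mono (union_subset_union hC'.subset (image_subset_range a S))
  rcases hx with hxC' | ⟨j, hj, rfl⟩
  · exact absurd (h.mem_right_of_mem_safe hC' hb hJ' hxC' hxJ) (h.right_notMem i)
  · obtain rfl := h.right_injective (h.eq_right_of_left_mem (hS j hj) hb hJ' hxJ)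
    exact ⟨hj, rfl⟩

lemma not_isParallelCircuit_right (h : IsFanSystem M N T θ C₀ D₀ a b F)
    (hC' : IsSafe M C₀ D₀ C') (hS : ∀ j ∈ S, IsMaxFanEnd M T (a j) (b j) (F j)) (i : ι)
    (J : Set α) : ¬ IsParallelCircuit M (C' ∪ a '' S) (b i) J := by
  intro hJ
  have heq {z : α} := h.eq_left_of_mem_circuit (x := z) hC' (fun j hj ↦ (hS j hj).toIsFanEnd) hJ
  have h3 := h.free.three_le_ncard_circuit hJ.isCircuit
  by_cases hi : i ∈ S ∧ a i ∈ J
  · have hsub : J \ {b i, a i} ⊆ J \ insert (b i) (C' ∪ a '' S) := fun z ⟨hzJ, hz⟩ ↦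
      ⟨hzJ, fun hz' ↦ hz (hz'.imp_right fun hz'' ↦ (heq hzJ hz'').2)⟩
    have h1 := subsingleton_ncard_le_one (hJ.sdiff_subsingleton.anti hsub)
    have h2 := ncard_le_ncard_sdiff_add_ncard J {b i, a i}
    have h4 := ncard_insert_le (b i) {a i}
    rw [ncard_singleton] at h4
    exact (hS i hi.1).ncard_ne J hJ.isCircuit hi.2 (by omega)
  · have hsub : J \ {b i} ⊆ J \ insert (b i) (C' ∪ a '' S) := by
      refine fun z ⟨hzJ, hz⟩ ↦ ⟨hzJ, fun hz' ↦ ?_⟩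
      obtain ⟨hiS, rfl⟩ := heq hzJ (hz'.resolve_left hz)
      exact hi ⟨hiS, hzJ⟩
    have h1 := subsingleton_ncard_le_one (hJ.sdiff_subsingleton.anti hsub)
    have h2 := ncard_le_ncard_sdiff_add_ncard J {b i}
    rw [ncard_singleton] at h2
    omega

lemma not_isParallelCircuit_union_image (h : IsFanSystem M N T θ C₀ D₀ a b F)
    (hC' : IsSafe M C₀ D₀ C') (hS : ∀ i ∈ S, IsMaxFanEnd M T (a i) (b i) (F i))
    (hd : d ∈ D₀) (J : Set α) : ¬ IsParallelCircuit M (C' ∪ a '' S) d J := by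
  intro hJ
  have hJ' := hJ.mono (union_subset_union hC'.subset (image_subset_range a S))
  refine hC'.not_isParallelCircuit d hd J
    ⟨hJ.isCircuit, hJ.mem, hJ.sdiff_subsingleton.anti fun z ⟨hzJ, hz⟩ ↦ ⟨hzJ, ?_⟩⟩
  rintro (hzd | hzC' | ⟨i, hi, rfl⟩)
  · exact hz (Or.inl hzd)
  · exact hz (Or.inr hzC')
  · exact h.right_notMem i <|
      h.eq_right_of_left_mem (hS i hi).toIsFanEnd (Or.inl hd) hJ' hzJ ▸ hd

lemma isFreeContraction (h : IsFanSystem M N T θ C₀ D₀ a b F) (hC' : IsSafe M C₀ D₀ C')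
    (hS : ∀ i ∈ S, IsMaxFanEnd M T (a i) (b i) (F i)) :
    IsFreeContraction M N T θ (C' ∪ a '' S) :=
  h.free.isFreeContraction (union_subset_union hC'.subset (image_subset_range a S))
    fun d hd J ↦ by
      rcases hd with hd | ⟨i, rfl⟩
      · exact h.not_isParallelCircuit_union_image hC' hS hd J
      · exact h.not_isParallelCircuit_right hC' hS i J

lemma ncard_union_image [Finite ι] (h : IsFanSystem M N T θ C₀ D₀ a b F) (hC' : C' ⊆ C₀) :
    (C' ∪ a '' S).ncard = C'.ncard + S.ncard := by
  have hC₀ := M.set_finite _ h.free.left_subset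
  rw [ncard_union_eq ?_ (hC₀.subset (hC'.trans subset_union_left)) (toFinite _),
    ncard_image_of_injective _ h.left_injective]
  rw [disjoint_left]
  rintro z hz ⟨i, -, rfl⟩
  exact h.left_notMem i (hC' hz)

end IsFanSystem

end FanSystem

/-! ### Restoring elements -/

lemma IsParallelCircuit.of_inter_subset (hJ : IsParallelCircuit M C d J) (hJC : J ∩ C ⊆ C₁) :
    IsParallelCircuit M C₁ d J :=
  ⟨hJ.isCircuit, hJ.mem, hJ.sdiff_subsingleton.anti fun _ ⟨hz, hzC₁⟩ ↦
    ⟨hz, fun hzC ↦ hzC₁ (hzC.imp_right fun hzC' ↦ hJC ⟨hz, hzC'⟩)⟩⟩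

namespace IsFreeMinor

variable [M.Finite]

lemma inter_left_subset (h : IsFreeMinor M N T θ C D) (hC₁ : C₁ ⊆ C) (hd : d ∈ D)
    (hJ : IsParallelCircuit M C₁ d J) : J ∩ C ⊆ C₁ := by
  rintro z ⟨hzJ, hzC⟩
  obtain ⟨g, hg, hJg⟩ := h.exists_sdiff_eq_singleton hC₁ hd hJ
  by_contra hzC₁
  have hzd : z ≠ d := fun hzd ↦ h.disjoint.le_bot ⟨hzC, hzd ▸ hd⟩
  have hzg : z = g := hJg.subset ⟨hzJ, fun hz ↦ hz.elim hzd hzC₁⟩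
  exact hg (hzg ▸ Or.inl hzC)

lemma inter_left_nonempty (h : IsFreeMinor M N T θ C D) (hJ : IsParallelCircuit M C₁ d J) :
    (J ∩ C₁).Nonempty := by
  by_contra hempty
  have hsub : J \ {d} ⊆ J \ insert d C₁ := fun z ⟨hzJ, hzd⟩ ↦
    ⟨hzJ, fun hz ↦ hempty ⟨z, hzJ, hz.resolve_left hzd⟩⟩
  have h1 := h.three_le_ncard_circuit hJ.isCircuit
  have h2 := subsingleton_ncard_le_one (hJ.sdiff_subsingleton.anti hsub)
  have h3 := ncard_le_ncard_sdiff_add_ncard J {d}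
  rw [ncard_singleton] at h3
  omega

lemma exists_forall_mem_parallelCircuit (h : IsFreeMinor M N T θ C D) :
    ∃ φ : α → α, ∀ d ∈ D, ∀ J, IsParallelCircuit M C d J → φ d ∈ J ∩ C := by
  have hex (d : α) : ∃ v, d ∈ D → ∀ J, IsParallelCircuit M C d J → v ∈ J ∩ C := by
    by_cases hd : d ∈ D ∧ ∃ J, IsParallelCircuit M C d J
    · obtain ⟨hd, J, hJ⟩ := hd
      obtain ⟨v, hv⟩ := h.inter_left_nonempty hJ
      exact ⟨v, fun _ L hL ↦ h.parallelCircuit_unique hd hJ hL ▸ hv⟩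
    · exact ⟨d, fun hd' J hJ ↦ absurd ⟨hd', J, hJ⟩ hd⟩
  choose φ hφ using hex
  exact ⟨φ, hφ⟩

lemma exists_parallelCircuit_of_not_restore (h : IsFreeMinor M N T θ C D) (hd : d ∈ D)
    (hnot : ¬ IsKConnected (M ／ C ＼ (D \ {d})) 3) : ∃ J, IsParallelCircuit M C d J := by
  rcases h.exists_parallelCircuit_of_not_isKConnected Subset.rfl sdiff_subset hnot with
    ⟨d', hd', J, hJ⟩ | ⟨c, hc, -⟩
  · rw [sdiff_sdiff_cancel_left (singleton_subset_iff.2 hd)] at hd'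
    obtain rfl : d' = d := hd'
    exact ⟨J, hJ⟩
  · exact absurd hc.1 hc.2

lemma exists_parallelCocircuit_of_not_restore (h : IsFreeMinor M N T θ C D) (hc : c ∈ C)
    (hnot : ¬ IsKConnected (M ／ (C \ {c}) ＼ D) 3) : ∃ K, IsParallelCircuit M✶ D c K := by
  refine h.dual.exists_parallelCircuit_of_not_restore hc fun hcon ↦ hnot ?_
  rwa [← isKConnected_dual_iff, Matroid.dual_contract_delete,
    ← Matroid.contract_delete_comm _ (h.disjoint.symm.mono_right sdiff_subset)]

lemma mem_circuit_of_restore (h : IsFreeMinor M N T θ C D) (hd : d ∈ D)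
    (hJ : IsParallelCircuit M C d J) (hcon : IsKConnected (M ／ (C \ {c}) ＼ (D \ {d})) 3) :
    c ∈ J := by
  by_contra hcJ
  have hsub : (J \ (C \ {c})) \ {d} ⊆ J \ insert d C := fun z ⟨⟨hzJ, hz⟩, hzd⟩ ↦
    ⟨hzJ, fun hzC ↦ hz ⟨hzC.resolve_left hzd, fun hzc ↦ hcJ (hzc ▸ hzJ)⟩⟩
  have hJC : ¬ J ⊆ C \ {c} := fun hs ↦ h.disjoint.le_bot ⟨(hs hJ.mem).1, hd⟩
  have hdep : (M ／ (C \ {c}) ＼ (D \ {d})).Dep (J \ (C \ {c})) := by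
    refine Matroid.delete_dep_iff.2 ⟨hJ.isCircuit.contract_dep_of_not_subset hJC, ?_⟩
    exact disjoint_left.2 fun z hz hzD ↦
      hzD.2 ((h.inter_right_eq_singleton Subset.rfl hd hJ).subset ⟨hz.1, hzD.1⟩)
  have h1 := hcon.le_ncard_of_dep (by
    have h4 := h.four_le_ncard_compl
    have hle := ncard_le_ncard (sdiff_subset_sdiff_right (union_subset_union
      (sdiff_subset : C \ {c} ⊆ C) (sdiff_subset : D \ {d} ⊆ D))) (M.ground_finite.sdiff)
    rw [contract_delete_ground]
    omega) hdep
  have h2 := subsingleton_ncard_le_one (hJ.sdiff_subsingleton.anti hsub)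
  have h3 := ncard_le_ncard_sdiff_add_ncard (J \ (C \ {c})) {d}
  rw [ncard_singleton] at h3
  omega

lemma restore_of_mem_cocircuit (h : IsFreeMinor M N T θ C D) (hc : c ∈ C) (hd : d ∈ D)
    (hK : IsParallelCircuit M✶ D c K) (hJ : IsParallelCircuit M C d J) (hdK : d ∈ K) :
    IsKConnected (M ／ (C \ {c}) ＼ (D \ {d})) 3 := by
  by_contra hnot
  rcases h.exists_parallelCircuit_of_not_isKConnected sdiff_subset sdiff_subset hnot with
    ⟨d', hd', L, hL⟩ | ⟨c', hc', L, hL⟩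
  · rw [sdiff_sdiff_cancel_left (singleton_subset_iff.2 hd)] at hd'
    obtain rfl : d' = d := hd'
    obtain rfl := h.parallelCircuit_unique hd (hL.mono sdiff_subset) hJ
    have hcL := (h.mem_circuit_iff_mem_cocircuit hc hd hK hJ).2 hdK
    exact (h.inter_left_subset sdiff_subset hd hL ⟨hcL, hc⟩).2 rfl
  · rw [sdiff_sdiff_cancel_left (singleton_subset_iff.2 hc)] at hc'
    obtain rfl : c' = c := hc'
    obtain rfl := h.dual.parallelCircuit_unique hc (hL.mono sdiff_subset) hK
    exact (h.dual.inter_left_subset sdiff_subset hc hL ⟨hdK, hd⟩).2 rfl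

lemma isFanEnd (h : IsFreeMinor M N T θ C D) (hc : c ∈ C) (hd : d ∈ D)
    (hK : IsParallelCircuit M✶ D c K) (hdK : d ∈ K) (hKD : K ∩ D ⊆ {d}) :
    IsFanEnd M T c d K := by
  obtain ⟨f, -, hKf⟩ := h.dual.exists_sdiff_eq_singleton Subset.rfl hc hK
  have hKeq : K = {c, d, f} := by
    have hKi : K ∩ insert c D = {c, d} := Subset.antisymm
      (fun z ⟨hzK, hz⟩ ↦ hz.imp_right fun hzD ↦ hKD ⟨hzK, hzD⟩)
      (insert_subset ⟨hK.mem, Or.inl rfl⟩ (singleton_subset_iff.2 ⟨hdK, Or.inr hd⟩))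
    rw [← inter_union_sdiff K (insert c D), hKf, hKi, insert_union, singleton_union]
  have hKE : K ⊆ M.E := hK.isCircuit.subset_ground
  have hKfin := M.set_finite K hKE
  have hcard : K.ncard ≤ 3 := by
    have h1 := ncard_insert_le c {d, f}
    have h2 := ncard_insert_le d {f}
    rw [ncard_singleton] at h2
    rw [hKeq]
    omega
  have hθ := h.four_le_order
  have hconn := conn_lt_ncard_of_dep hK.isCircuit.dep
  rw [conn_dual M hKE] at hconn
  exact {
    left_mem := hK.mem
    right_mem := hdK
    exists_triad := ⟨f, (hKf.superset rfl).1, hKeq ▸ hK.isCircuit⟩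
    mem := h.isTangle.mem_of_ncard_lt hKE (by omega)
    conn_le := by omega
    conn_sdiff_le := by
      have h1 := conn_le_ncard M (hKfin.sdiff (t := {c}))
      have h2 := ncard_sdiff_singleton_add_one hK.mem hKfin
      omega }

end IsFreeMinor

section RestorationMatching

variable {ι : Type*}

/-- The pairs `c i`, `d i` form an induced matching of the restoration graph of the free minor
`M ／ C ＼ D`, and restoring any one of these elements creates a series or parallel pair: in `M ／ C`
the element `d i` is parallel to another one along the circuit `J i`, and in `M ＼ D` the element
`c i` is in series with another one along the cocircuit `K i`. -/
structure IsRestorationMatching (M N : Matroid α) (T : Set (Set α)) (θ : ℕ) (C D : Set α)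
    (c d : ι → α) (J K : ι → Set α) : Prop where
  free : IsFreeMinor M N T θ C D
  left_mem : ∀ i, c i ∈ C
  right_mem : ∀ i, d i ∈ D
  circuit : ∀ i, IsParallelCircuit M C (d i) (J i)
  cocircuit : ∀ i, IsParallelCircuit M✶ D (c i) (K i)
  mem_cocircuit_iff : ∀ i j, d j ∈ K i ↔ i = j

/-- The indices `i` for which `L i` meets `A` outside `e i`. -/
def excessIndices (A : Set α) (e : ι → α) (L : ι → Set α) : Set ι := {i | ¬ L i ∩ A ⊆ {e i}}

/-- The unmatched elements of `D` that are parallel to another element in `M ／ c '' Y`. Contracting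
`c '' Y` would make them parallel, so each of them costs one element of `c '' Y`, but they can be
deleted instead. -/
def coveredElements (M : Matroid α) (C D : Set α) (c d : ι → α) (Y : Set ι) : Set α :=
  {u ∈ D | u ∉ range d ∧ ∃ L, IsParallelCircuit M C u L ∧ L ∩ C ⊆ c '' Y}

lemma coveredElements_subset {c d : ι → α} {Y : Set ι} :
    coveredElements M C D c d Y ⊆ D := sep_subset _ _

namespace IsRestorationMatching

variable {c d : ι → α} {J K : ι → Set α} {I Y : Set ι} {i j : ι} [M.Finite]

lemma mem_circuit_iff (h : IsRestorationMatching M N T θ C D c d J K) (i j : ι) :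
    c i ∈ J j ↔ i = j :=
  (h.free.mem_circuit_iff_mem_cocircuit (h.left_mem i) (h.right_mem j) (h.cocircuit i)
    (h.circuit j)).trans (h.mem_cocircuit_iff i j)

lemma left_injective (h : IsRestorationMatching M N T θ C D c d J K) : c.Injective :=
  fun i j hij ↦ by rw [← h.mem_circuit_iff, hij, h.mem_circuit_iff]

omit [M.Finite] in
lemma right_injective (h : IsRestorationMatching M N T θ C D c d J K) : d.Injective :=
  fun i j hij ↦ by rw [← h.mem_cocircuit_iff, ← hij, h.mem_cocircuit_iff]

lemma isFanSystem (h : IsRestorationMatching M N T θ C D c d J K)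
    (hI : ∀ i ∈ I, K i ∩ D ⊆ {d i}) :
    IsFanSystem M N T θ (C \ c '' I) (D \ d '' I) (fun i : I ↦ c i) (fun i : I ↦ d i)
      (fun i : I ↦ K i) where
  free := by
    have hc : c '' I ⊆ C := image_subset_iff.2 fun i _ ↦ h.left_mem i
    have hd : d '' I ⊆ D := image_subset_iff.2 fun i _ ↦ h.right_mem i
    rw [← image_eq_range, ← image_eq_range, sdiff_union_of_subset hc, sdiff_union_of_subset hd]
    exact h.free
  left_injective := h.left_injective.comp Subtype.val_injective
  right_injective := h.right_injective.comp Subtype.val_injective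
  left_notMem i hi := hi.2 (mem_image_of_mem c i.2)
  right_notMem i hi := hi.2 (mem_image_of_mem d i.2)
  fan i := Or.inl (h.free.isFanEnd (h.left_mem i) (h.right_mem i) (h.cocircuit i)
    ((h.mem_cocircuit_iff i i).2 rfl) (hI i i.2))

lemma dual (h : IsRestorationMatching M N T θ C D c d J K) :
    IsRestorationMatching M✶ N✶ T θ D C d c K J where
  free := h.free.dual
  left_mem := h.right_mem
  right_mem := h.left_mem
  circuit := h.cocircuit
  cocircuit i := by
    rw [Matroid.dual_dual]
    exact h.circuit i
  mem_cocircuit_iff i j := (h.mem_circuit_iff j i).trans eq_comm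

lemma isParallelCircuit_sdiff_image (h : IsRestorationMatching M N T θ C D c d J K)
    (hi : i ∉ I) : IsParallelCircuit M (C \ c '' I) (d i) (J i) := by
  refine (h.circuit i).of_inter_subset fun z ⟨hzJ, hzC⟩ ↦ ⟨hzC, ?_⟩
  rintro ⟨j, hj, rfl⟩
  exact hi ((h.mem_circuit_iff j i).1 hzJ ▸ hj)

lemma image_subset_sdiff_image (h : IsRestorationMatching M N T θ C D c d J K)
    (hYI : Disjoint Y I) : c '' Y ⊆ C \ c '' I :=
  subset_sdiff.2 ⟨image_subset_iff.2 fun i _ ↦ h.left_mem i,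
    (disjoint_image_iff h.left_injective).2 hYI⟩

lemma not_isParallelCircuit_left {φ : α → α} (h : IsRestorationMatching M N T θ C D c d J K)
    (hφ : ∀ u ∈ D, ∀ L, IsParallelCircuit M C u L → φ u ∈ L ∩ C) (he : e ∈ D) (L : Set α) :
    ¬ IsParallelCircuit M (c '' excessIndices C c J \
      φ '' coveredElements M C D c d (excessIndices C c J)) e L := by
  set Y := excessIndices C c J
  intro hL
  have hYC : c '' Y \ φ '' coveredElements M C D c d Y ⊆ C :=
    sdiff_subset.trans (image_subset_iff.2 fun i _ ↦ h.left_mem i)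
  have hLC := h.free.inter_left_subset hYC he hL
  by_cases her : e ∈ range d
  · obtain ⟨j, rfl⟩ := her
    obtain rfl := h.free.parallelCircuit_unique he (hL.mono hYC) (h.circuit j)
    obtain ⟨i, hi, hij⟩ := (hLC ⟨(h.mem_circuit_iff j j).2 rfl, h.left_mem j⟩).1
    obtain rfl := h.left_injective hij
    refine hi fun z hz ↦ ?_
    obtain ⟨k, -, rfl⟩ := (hLC hz).1
    exact congrArg c ((h.mem_circuit_iff k i).1 hz.1)
  · have hφL := hφ e he L (hL.mono hYC)
    exact (hLC hφL).2
      (mem_image_of_mem φ ⟨he, her, L, hL.mono hYC, fun z hz ↦ (hLC hz).1⟩)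

lemma isSafe_left {φ : α → α} (h : IsRestorationMatching M N T θ C D c d J K)
    (hφ : ∀ u ∈ D, ∀ L, IsParallelCircuit M C u L → φ u ∈ L ∩ C)
    (hI : Disjoint (excessIndices C c J) I) :
    IsSafe M (C \ c '' I) (D \ d '' I) (c '' excessIndices C c J \
      φ '' coveredElements M C D c d (excessIndices C c J)) where
  subset := sdiff_subset.trans (h.image_subset_sdiff_image hI)
  exists_cocircuit := by
    rintro _ ⟨⟨i, hi, rfl⟩, -⟩
    exact ⟨K i, h.dual.isParallelCircuit_sdiff_image (disjoint_left.1 hI hi)⟩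
  not_isParallelCircuit _ he := h.not_isParallelCircuit_left hφ he.1

lemma mem_image_of_coveredElements_mem (h : IsRestorationMatching M N T θ C D c d J K)
    (he : e ∈ C) (hL : IsParallelCircuit M✶ D e B) (hx : x ∈ coveredElements M C D c d Y)
    (hxB : x ∈ B) : e ∈ c '' Y := by
  obtain ⟨hxD, -, A, hA, hAY⟩ := hx
  exact hAY ⟨(h.free.mem_circuit_iff_mem_cocircuit he hxD hL hA).2 hxB, he⟩

lemma not_isParallelCircuit_right (h : IsRestorationMatching M N T θ C D c d J K) (he : e ∈ C)
    (L : Set α) :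
    ¬ IsParallelCircuit M✶ (d '' (excessIndices D d K \ excessIndices C c J) ∪
      coveredElements M C D c d (excessIndices C c J)) e L := by
  set Y := excessIndices C c J
  intro hL
  have hsub : d '' (excessIndices D d K \ Y) ∪ coveredElements M C D c d Y ⊆ D :=
    union_subset (image_subset_iff.2 fun i _ ↦ h.right_mem i) coveredElements_subset
  have hLD := h.free.dual.inter_left_subset hsub he hL
  have hL' := hL.mono hsub
  have hcovered (z : α) (hz : z ∈ coveredElements M C D c d Y) (hzL : z ∈ L) : e ∈ c '' Y :=
    h.mem_image_of_coveredElements_mem he hL' hz hzL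
  by_cases her : e ∈ range c
  · obtain ⟨j, rfl⟩ := her
    obtain rfl := h.free.dual.parallelCircuit_unique he hL' (h.cocircuit j)
    have hj : j ∈ excessIndices D d K \ Y := by
      rcases hLD ⟨(h.mem_cocircuit_iff j j).2 rfl, h.right_mem j⟩ with ⟨i, hi, hij⟩ | hjP
      · exact h.right_injective hij ▸ hi
      · exact absurd (mem_range_self j) hjP.2.1
    refine hj.1 fun z hz ↦ ?_
    rcases hLD hz with ⟨i, -, rfl⟩ | hzP
    · exact congrArg d ((h.mem_cocircuit_iff j i).1 hz.1).symm
    · obtain ⟨i, hi, hij⟩ := hcovered z hzP hz.1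
      exact absurd (h.left_injective hij ▸ hi) hj.2
  · obtain ⟨z, hzL, ⟨i, hi, rfl⟩ | hzP⟩ := h.free.dual.inter_left_nonempty hL
    · have hiJ := (h.free.mem_circuit_iff_mem_cocircuit he (h.right_mem i) hL' (h.circuit i)).2 hzL
      exact her ⟨i, (not_not.1 hi.2 ⟨hiJ, he⟩).symm⟩
    · exact her (image_subset_range c Y (hcovered z hzP hzL))

lemma isSafe_right (h : IsRestorationMatching M N T θ C D c d J K)
    (hYI : Disjoint (excessIndices C c J) I) (hXI : Disjoint (excessIndices D d K) I) :
    IsSafe M✶ (D \ d '' I) (C \ c '' I) (d '' (excessIndices D d K \ excessIndices C c J) ∪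
      coveredElements M C D c d (excessIndices C c J)) where
  subset := by
    refine union_subset (h.dual.image_subset_sdiff_image (hXI.mono_left sdiff_subset)) ?_
    exact fun z hz ↦ ⟨hz.1, fun hzI ↦ hz.2.1 (image_subset_range d I hzI)⟩
  exists_cocircuit := by
    rw [Matroid.dual_dual]
    rintro _ (⟨i, hi, rfl⟩ | ⟨-, -, L, hL, hLY⟩)
    · exact ⟨J i, h.isParallelCircuit_sdiff_image (disjoint_left.1 hXI hi.1)⟩
    · exact ⟨L, hL.of_inter_subset (hLY.trans (h.image_subset_sdiff_image hYI))⟩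
  not_isParallelCircuit _ he := h.not_isParallelCircuit_right he.1

lemma ncard_excessIndices_union_le [Finite ι] (h : IsRestorationMatching M N T θ C D c d J K)
    (φ : α → α) : (excessIndices C c J ∪ excessIndices D d K).ncard ≤
      (c '' excessIndices C c J \
        φ '' coveredElements M C D c d (excessIndices C c J)).ncard +
      (d '' (excessIndices D d K \ excessIndices C c J) ∪
        coveredElements M C D c d (excessIndices C c J)).ncard := by
  set Y := excessIndices C c J
  set X := excessIndices D d K
  set P := coveredElements M C D c d Y
  have hP : P.Finite := M.set_finite P (coveredElements_subset.trans h.free.right_subset)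
  have h1 : Y.ncard ≤ (c '' Y \ φ '' P).ncard + P.ncard := by
    have hsdiff := ncard_le_ncard_sdiff_add_ncard (c '' Y) (φ '' P) (hP.image φ)
    rw [ncard_image_of_injective _ h.left_injective] at hsdiff
    have := ncard_image_le (f := φ) hP
    omega
  have h2 : (d '' (X \ Y) ∪ P).ncard = (X \ Y).ncard + P.ncard := by
    rw [ncard_union_eq ?_ (toFinite _) hP, ncard_image_of_injective _ h.right_injective]
    exact disjoint_left.2 fun z hz hzP ↦ hzP.2.1 (image_subset_range d _ hz)
  have h3 := ncard_union_le Y (X \ Y)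
  rw [union_sdiff_self] at h3
  omega

lemma exists_isFreeContraction [Finite ι] (h : IsRestorationMatching M N T θ C D c d J K) :
    ∃ C' D', IsFreeContraction M N T θ C' ∧ IsFreeContraction M✶ N✶ T θ D' ∧
      Nat.card ι ≤ C'.ncard + D'.ncard := by
  set I := (excessIndices C c J ∪ excessIndices D d K)ᶜ
  obtain ⟨hYI, hXI⟩ := disjoint_union_left.1 (disjoint_compl_right : Disjoint _ I)
  obtain ⟨φ, hφ⟩ := h.free.exists_forall_mem_parallelCircuit
  have hC' := h.isSafe_left hφ hYI
  have hD' := h.isSafe_right hYI hXI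
  obtain ⟨a, b, F, hF, hmax⟩ := (h.isFanSystem (I := I) fun i hi ↦
    not_not.1 fun hiX ↦ hi (Or.inr hiX)).exists_isMaxFanEnd
  set S := {i | IsMaxFanEnd M T (a i) (b i) (F i)}
  set S' := {i | IsMaxFanEnd M✶ T (b i) (a i) (F i)}
  refine ⟨_, _, hF.isFreeContraction (S := S) hC' fun _ hi ↦ hi,
    hF.dual.isFreeContraction (S := S') hD' fun _ hi ↦ hi, ?_⟩
  rw [hF.ncard_union_image hC'.subset, hF.dual.ncard_union_image hD'.subset]
  have h1 := h.ncard_excessIndices_union_le φ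
  have h2 := ncard_union_le S S'
  rw [show S ∪ S' = univ from eq_univ_of_forall hmax, ncard_univ, Nat.card_coe_set_eq] at h2
  have h3 : (excessIndices C c J ∪ excessIndices D d K).ncard + I.ncard = Nat.card ι :=
    ncard_add_ncard_compl _
  omega

end IsRestorationMatching

end RestorationMatching

/-! ### The restoration graph -/

lemma exists_restorationEdge_iff_eq {hCD : Disjoint C D}
    {H : (restorationGraph M C D hCD).Subgraph} (hind : H.IsInduced) (hmatch : H.IsMatching) :
    ∃ c d : H.edgeSet → ↥(C ∪ D), (∀ i, c i ∈ H.verts) ∧ (∀ i, d i ∈ H.verts) ∧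
      ∀ i j, RestorationEdge M C D (c i) (d j) ↔ i = j := by
  have hex (i : H.edgeSet) : ∃ c d, i.1 = s(c, d) ∧ H.Adj c d ∧ RestorationEdge M C D c d := by
    obtain ⟨⟨v, w⟩, hvw⟩ := i
    rcases hvw.adj_sub with h | h
    · exact ⟨v, w, rfl, hvw, h⟩
    · exact ⟨w, v, Sym2.eq_swap, hvw.symm, h⟩
  choose c d hs hadj hedge using hex
  refine ⟨c, d, fun i ↦ (hadj i).fst_mem, fun i ↦ (hadj i).snd_mem, fun i j ↦ ⟨fun hij ↦ ?_, ?_⟩⟩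
  · have hcd : H.Adj (c i) (d j) := hind (hadj i).fst_mem (hadj j).snd_mem (Or.inl hij)
    have hc : c i = c j := hmatch.eq_of_adj_right hcd (hadj j)
    have hd : d i = d j := hmatch.eq_of_adj_left (hadj i) hcd
    exact Subtype.ext (by rw [hs, hs, hc, hd])
  · rintro rfl
    exact hedge i

section

variable {ι : Type*} {c d : ι → α}

lemma two_mul_card_le_ncard_union (hC : C.Finite) (hD : D.Finite) (hCD : Disjoint C D)
    (hcd : ∀ i j, RestorationEdge M C D (c i) (d j) ↔ i = j) :
    2 * Nat.card ι ≤ (C ∪ D).ncard := by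
  have hc : c.Injective := fun i j hij ↦ (hcd i j).1 (hij ▸ (hcd j j).2 rfl)
  have hd : d.Injective := fun i j hij ↦ (hcd i j).1 (hij ▸ (hcd i i).2 rfl)
  have h1 : Nat.card ι ≤ C.ncard := by
    rw [← Nat.card_range_of_injective hc]
    exact ncard_le_ncard (range_subset_iff.2 fun i ↦ ((hcd i i).2 rfl).1) hC
  have h2 : Nat.card ι ≤ D.ncard := by
    rw [← Nat.card_range_of_injective hd]
    exact ncard_le_ncard (range_subset_iff.2 fun i ↦ ((hcd i i).2 rfl).2.1) hD
  rw [ncard_union_eq hCD hC hD]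
  omega

lemma IsFreeMinor.exists_isRestorationMatching [M.Finite] (h : IsFreeMinor M N T θ C D)
    (hcd : ∀ i j, RestorationEdge M C D (c i) (d j) ↔ i = j)
    (hc : ∀ i, ¬ IsPrivileged M C D (c i)) (hd : ∀ i, ¬ IsPrivileged M C D (d i)) :
    ∃ J K, IsRestorationMatching M N T θ C D c d J K := by
  have hedge (i : ι) := (hcd i i).2 rfl
  have hexJ (i : ι) : ∃ J, IsParallelCircuit M C (d i) J := by
    refine h.exists_parallelCircuit_of_not_restore (hedge i).2.1 ?_
    have := hd i
    rwa [IsPrivileged, restore,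
      sdiff_singleton_eq_self (disjoint_right.1 h.disjoint (hedge i).2.1)] at this
  have hexK (i : ι) : ∃ K, IsParallelCircuit M✶ D (c i) K := by
    refine h.exists_parallelCocircuit_of_not_restore (hedge i).1 ?_
    have := hc i
    rwa [IsPrivileged, restore,
      sdiff_singleton_eq_self (disjoint_left.1 h.disjoint (hedge i).1)] at this
  choose J hJ using hexJ
  choose K hK using hexK
  refine ⟨J, K, h, fun i ↦ (hedge i).1, fun i ↦ (hedge i).2.1, hJ, hK, fun i j ↦ ?_⟩
  rw [← hcd]
  refine ⟨fun hdK ↦ ⟨(hedge i).1, (hedge j).2.1,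
    h.restore_of_mem_cocircuit (hedge i).1 (hedge j).2.1 (hK i) (hJ j) hdK⟩, fun hij ↦ ?_⟩
  exact (h.mem_circuit_iff_mem_cocircuit (hedge i).1 (hedge j).2.1 (hK i) (hJ j)).1
    (h.mem_circuit_of_restore (hedge j).2.1 (hJ j) hij.2.2)

end

end MatroidTangle

open MatroidTangle in
theorem mainTheorem7 {α : Type*} (k : ℤ) (M N : Matroid α) [M.Finite]
    (hM : IsKConnected M 3)
    (T : Set (Set α)) (θ : ℕ) (hT : IsTangle M T θ)
    (C D : Set α) (hC : C ⊆ M.E) (hD : D ⊆ M.E) (hCD : Disjoint C D)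
    (hMCD : IsKConnected (M ／ C ＼ D) 3)
    (hN : N ≤m M ／ C ＼ D)
    (hrank : tangleRank M T θ (N.E ∪ C ∪ D) = tangleRank M T θ N.E + (C ∪ D).ncard)
    (H : (restorationGraph M C D hCD).Subgraph)
    (hind : H.IsInduced) (hmatch : H.IsMatching)
    (hcard : 2 * k ≤ (H.edgeSet.ncard : ℤ))
    (hpriv : ∀ v ∈ H.verts, ¬ IsPrivileged M C D v) :
    (∃ C' ⊆ M.E, tangleRank M T θ (N.E ∪ C') = tangleRank M T θ N.E + C'.ncard ∧
      k ≤ (C'.ncard : ℤ) ∧ IsKConnected (M ／ C') 3 ∧ N ≤m M ／ C') ∨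
    (∃ D' ⊆ M.E, tangleRank M T θ (N.E ∪ D') = tangleRank M T θ N.E + D'.ncard ∧
      k ≤ (D'.ncard : ℤ) ∧ IsKConnected (M ＼ D') 3 ∧ N ≤m M ＼ D') := by
  obtain hk | hk := le_or_gt k 0
  · refine Or.inl ⟨∅, empty_subset _, by simp, by simpa using hk, by simpa using hM, ?_⟩
    rw [Matroid.contract_empty]
    exact hN.trans ⟨C, D, rfl⟩
  obtain ⟨c, d, hc, hd, hcd⟩ := exists_restorationEdge_iff_eq hind hmatch
  have hCfin := M.set_finite C
  have hDfin := M.set_finite D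
  have hle := two_mul_card_le_ncard_union hCfin hDfin hCD hcd
  rw [Nat.card_coe_set_eq] at hle
  have h : IsFreeMinor M N T θ C D := ⟨hM, hT, hC, hD, hCD, hMCD, hN, hrank, by omega⟩
  obtain ⟨J, K, hJK⟩ := h.exists_isRestorationMatching hcd (fun i ↦ hpriv _ (hc i))
    fun i ↦ hpriv _ (hd i)
  have : Finite ↥(C ∪ D) := (hCfin.union hDfin).to_subtype
  obtain ⟨C', D', hC', hD', hcardle⟩ := hJK.exists_isFreeContraction
  rw [Nat.card_coe_set_eq] at hcardle
  by_cases hkC : k ≤ C'.ncard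
  · exact Or.inl ⟨C', hC'.subset_ground, hC'.rank_eq, hkC, hC'.isKConnected, hC'.isMinor⟩
  · obtain ⟨hD'E, hD'rank, hD'conn, hD'minor⟩ := hD'.of_dual hT
    exact Or.inr ⟨D', hD'E, hD'rank, by omega, hD'conn, hD'minor⟩
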